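/- \textbf{Setting.} Let $f=(f_1,\dots,f_n)$ and $g_1,\dots,g_m$ be real polynomials in $\mathbf x=(x_1,\dots,x_n)$, let $\mathbf X=\{\mathbf x\in\mathbb R^n: g_1(\mathbf x)\ge 0,\dots,g_m(\mathbf x)\ge 0\}$, and assume that some $g_j$ equals $N-\|\mathbf x\|_2^2$ for an integer $N$. Let $\lambda_{\mathbf X}$ be the Lebesgue measure on $\mathbf X$, with moments $z_\alpha=\int \mathbf x^\alpha\,d\lambda_{\mathbf X}$, and let $\mathcal M_+(\mathbf X)$ be the set of finite nonnegative Borel measures on $\mathbf X$. We consider either the discrete-time system $\mathbf x_{t+1}=f(\mathbf x_t)$ or the continuous-time system $\dot{\mathbf x}=f(\mathbf x)$. A measure $\mu\in\mathcal M_+(\mathbf X)$ is invariant, written $\mathcal L(\mu)=0$, if $f_\#\mu=\mu$ (discrete time), respectively if $\int \nabla\varphi\cdot f\,d\mu=0$ for every $\varphi\in C^1(\mathbb R^n)$, i.e. $\mathrm{div}(f\mu)=0$ (continuous time). \textbf{LP.} Let $$\rho^\star_{\rm sing}=\sup\ \nu(\mathbf X)\quad\text{s.t.}\quad \mu(\mathbf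 X)=1,\ \mathcal L(\mu)=0,\ \nu+\psi=\mu,\ \nu+\hat\nu=\lambda_{\mathbf X},\ \mu,\nu,\hat\nu,\psi\in\mathcal M_+(\mathbf X).$$ \textbf{SDP.} For a real sequence $\mathbf y=(y_\beta)_{\beta\in\mathbb N^n}$ put $\ell_{\mathbf y}(\sum_\beta p_\beta \mathbf x^\beta)=\sum_\beta p_\beta y_\beta$. Let $\mathscr I_{\mathbf y}(p)=\ell_{\mathbf y}(p\circ f)-\ell_{\mathbf y}(p)$ in discrete time and $\mathscr I_{\mathbf y}(p)=\ell_{\mathbf y}(\nabla p\cdot f)$ in continuous time. For a polynomial $g$ let $\mathbf M_s(g\,\mathbf y)=\big(\ell_{\mathbf y}(g\,\mathbf x^{\beta+\gamma})\big)_{|\beta|,|\gamma|\le s}$. Put $g_0=1$, $r_j=\lceil \deg g_j/2\rceil$ and $r_{\min}=\max\{1,r_1,\dots,r_m\}$. For $r\ge r_{\min}$, let $\rho^r_{\rm sing}$ be the supremum of $v_0$ over $(\mathbf u,\mathbf v,\hat{\mathbf v},\mathbf y)$ subject to $$u_0=1,\qquad \mathscr I_{\mathbf u}(\mathbf x^\alpha)=0,\qquad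 v_\alpha+y_\alpha=u_\alpha,\qquad v_\alpha+\hat v_\alpha=z_\alpha\qquad(|\alpha|\le 2r),$$ $$\mathbf M_{r-r_j}(g_j\mathbf u),\ \mathbf M_{r-r_j}(g_j\mathbf v),\ \mathbf M_{r-r_j}(g_j\hat{\mathbf v}),\ \mathbf M_{r-r_j}(g_j\mathbf y)\succeq 0\qquad (j=0,\dots,m).$$ Here $\mathbf v,\hat{\mathbf v},\mathbf y$ are indexed by $|\alpha|\le 2r$ and $\mathbf u$ by the $\alpha$ with $|\alpha|\le D_r$. With $d_f=\max_i\deg f_i$, the degree $D_r$ is $2r\max\{1,d_f\}$ in discrete time and $2r+\max\{d_f-1,0\}$ in continuous time, so that all the constraints make sense. All four vectors are completed by zeros to sequences indexed by $\mathbb N^n$. \textbf{Theorem.} Assume that there is a unique invariant probability measure $\mu^\star\in\mathcal M_+(\mathbf X)$. Let $\mu^\star=h^\star\lambda_{\mathbf X}+\psi^\star$ be its Lebesgue decomposition with respect to $\lambda_{\mathbf X}$, and let $\nu_1^\star=\min\{1,h^\star\}\,\lambda_{\mathbf X}$. Then: \begin{enumerate} \item $(\mu^\star,\nu_1^\star,\lambda_{\mathbf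 X}-\nu_1^\star,\mu^\star-\nu_1^\star)$ is the unique optimal solution of the LP. \item For every $r\ge r_{\min}$ the SDP of order $r$ has an optimal solution. If $(\mathbf u^r,\mathbf v^r,\hat{\mathbf v}^r,\mathbf y^r)$ is an arbitrary optimal solution for every $r\ge r_{\min}$, then for every $\alpha\in\mathbb N^n$, as $r\to\infty$, $$u^r_\alpha\to u^\star_\alpha,\qquad v^r_\alpha\to v^\star_\alpha,\qquad \hat v^r_\alpha\to z_\alpha-v^\star_\alpha,\qquad y^r_\alpha\to u^\star_\alpha-v^\star_\alpha,$$ where $\mathbf u^\star$ and $\mathbf v^\star$ are the moment sequences of $\mu^\star$ and $\nu_1^\star$. Moreover $(z_\alpha-v_\alpha^\star)_\alpha$ and $(u_\alpha^\star-v_\alpha^\star)_\alpha$ are the moment sequences of $\lambda_{\mathbf X}-\nu_1^\star$ and $\mu^\star-\nu_1^\star$. \item $\lim_{r\to\infty}\rho^r_{\rm sing}=\rho^\star_{\rm sing}$. \end{enumerate} -/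

import Mathlib

open MeasureTheory Filter Topology

namespace InvariantSDP

noncomputable section

/-- The two kinds of polynomial systems: `x_{t+1} = f(x_t)` and `x'(t) = f(x(t))`. -/
inductive TimeDomain
  | discrete
  | continuous

/-- The data of a polynomial system on `ℝⁿ`: discrete or continuous time, the components
`f₁, …, fₙ` of the dynamics and the polynomials `g₁, …, g_m` of the state constraints. -/
structure PolySystem (n m : ℕ) where
  time : TimeDomain
  f : Fin n → MvPolynomial (Fin n) ℝ
  g : Fin m → MvPolynomial (Fin n) ℝ

/-! ### Measures -/

namespace PolySystem

variable {n m : ℕ} (S : PolySystem n m)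

/-- The basic semialgebraic set `X = {x : g₁(x) ≥ 0, …, g_m(x) ≥ 0}`. -/
def X : Set (Fin n → ℝ) := {x | ∀ j, 0 ≤ MvPolynomial.eval x (S.g j)}

/-- The polynomial map `f : ℝⁿ → ℝⁿ`. -/
def map (x : Fin n → ℝ) : Fin n → ℝ := fun i => MvPolynomial.eval x (S.f i)

/-- Algebraic compactness: some `g_j` equals `N - ‖x‖₂²` for an integer `N`. -/
def Archimedean : Prop :=
  ∃ (N : ℤ) (j : Fin m), S.g j = MvPolynomial.C (N : ℝ) - ∑ i, MvPolynomial.X i ^ 2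

/-- The Lebesgue measure on `X`. -/
def lebesgue : Measure (Fin n → ℝ) := volume.restrict S.X

/-- `μ` belongs to `M₊(X)`: a finite nonnegative Borel measure carried by `X`. -/
def IsMeasureOn (μ : Measure (Fin n → ℝ)) : Prop := IsFiniteMeasure μ ∧ μ S.Xᶜ = 0

/-- `L(μ) = 0`. In discrete time this is `f_# μ = μ`; in continuous time it is `div(f μ) = 0`,
tested against `C¹` functions. -/
def IsInvariant (μ : Measure (Fin n → ℝ)) : Prop :=
  match S.time with
  | .discrete => μ.map S.map = μ
  | .continuous =>
      ∀ φ : (Fin n → ℝ) → ℝ, ContDiff ℝ 1 φ → ∫ x, fderiv ℝ φ x (S.map x) ∂μ = 0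

/-- `μ` is an invariant probability measure on `X`. -/
def IsInvariantProbability (μ : Measure (Fin n → ℝ)) : Prop :=
  S.IsMeasureOn μ ∧ μ Set.univ = 1 ∧ S.IsInvariant μ

/-- With `μ = h λ_X + ψ` the Lebesgue decomposition of `μ` with respect to `λ_X`, this is the
measure `min(1, h) λ_X`. -/
def cappedPart (μ : Measure (Fin n → ℝ)) : Measure (Fin n → ℝ) :=
  S.lebesgue.withDensity fun x => min 1 (μ.rnDeriv S.lebesgue x)

end PolySystem

/-- The moment sequence `α ↦ ∫ x^α dμ`. -/
def momentSeq {n : ℕ} (μ : Measure (Fin n → ℝ)) (α : Fin n →₀ ℕ) : ℝ :=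
  ∫ x, ∏ i, x i ^ α i ∂μ

/-! ### The infinite-dimensional linear program -/

/-- The variables `(μ, ν, ν̂, ψ)` of the linear program. -/
structure MeasureQuad (n : ℕ) where
  mu : Measure (Fin n → ℝ)
  nu : Measure (Fin n → ℝ)
  nuHat : Measure (Fin n → ℝ)
  psi : Measure (Fin n → ℝ)

namespace PolySystem

variable {n m : ℕ} (S : PolySystem n m)

structure LPFeasible (q : MeasureQuad n) : Prop where
  mu_mem : S.IsMeasureOn q.mu
  nu_mem : S.IsMeasureOn q.nu
  nuHat_mem : S.IsMeasureOn q.nuHat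
  psi_mem : S.IsMeasureOn q.psi
  mass : q.mu Set.univ = 1
  invariant : S.IsInvariant q.mu
  nu_add_psi : q.nu + q.psi = q.mu
  nu_add_nuHat : q.nu + q.nuHat = S.lebesgue

/-- `q` is feasible and attains the maximal mass of the `ν`-component. -/
def LPOptimal (q : MeasureQuad n) : Prop :=
  S.LPFeasible q ∧ ∀ q', S.LPFeasible q' → q'.nu.real Set.univ ≤ q.nu.real Set.univ

/-- The optimal value `ρ*` of the linear program. -/
def lpValue : EReal :=
  ⨆ (q : MeasureQuad n) (_ : S.LPFeasible q), ((q.nu.real Set.univ : ℝ) : EReal)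

end PolySystem

/-! ### Moment and localizing matrices -/

/-- The linear functional `ℓ_y(p) = ∑_β p_β y_β`. -/
def riesz {n : ℕ} (y : (Fin n →₀ ℕ) → ℝ) (p : MvPolynomial (Fin n) ℝ) : ℝ :=
  ∑ β ∈ p.support, p.coeff β * y β

/-- The localizing matrix with entries `ℓ_y(g x^(β+γ))`, where `|β|, |γ| ≤ s`. -/
def locMatrix {n : ℕ} (s : ℕ) (g : MvPolynomial (Fin n) ℝ) (y : (Fin n →₀ ℕ) → ℝ) :
    Matrix {β : Fin n →₀ ℕ // β.degree ≤ s} {β : Fin n →₀ ℕ // β.degree ≤ s} ℝ :=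
  Matrix.of fun β γ => riesz y (g * MvPolynomial.monomial (β.1 + γ.1) 1)

/-- The half-degree `⌈deg g / 2⌉`. -/
def halfDeg {n : ℕ} (g : MvPolynomial (Fin n) ℝ) : ℕ := (g.totalDegree + 1) / 2

namespace PolySystem

variable {n m : ℕ} (S : PolySystem n m)

/-- `r_min = max {1, r₁, …, r_m}`. -/
def rMin : ℕ := max 1 (Finset.univ.sup fun j => halfDeg (S.g j))

/-- `d_f = max {deg f₁, …, deg fₙ}`. -/
def degF : ℕ := Finset.univ.sup fun i => (S.f i).totalDegree

/-- The functional `I_y`: `ℓ_y(p ∘ f) - ℓ_y(p)` in discrete time, `ℓ_y(grad p · f)` in continuous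
time. -/
def invFunctional (y : (Fin n →₀ ℕ) → ℝ) (p : MvPolynomial (Fin n) ℝ) : ℝ :=
  match S.time with
  | .discrete => riesz y (MvPolynomial.bind₁ S.f p) - riesz y p
  | .continuous => riesz y (∑ i, MvPolynomial.pderiv i p * S.f i)

/-- A bound for `2r` and for the degrees of the moments which occur in `I_y(x^α)` for
`|α| ≤ 2r`. -/
def truncDegree (r : ℕ) : ℕ :=
  match S.time with
  | .discrete => 2 * r * max 1 S.degF
  | .continuous => 2 * r + (S.degF - 1)

/-- All the constraints `M_{r - r_j}(g_j y) ⪰ 0`, `j = 0, …, m`, where `g₀ = 1`. -/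
def LocPSD (r : ℕ) (y : (Fin n →₀ ℕ) → ℝ) : Prop :=
  (locMatrix r 1 y).PosSemidef ∧ ∀ j, (locMatrix (r - halfDeg (S.g j)) (S.g j) y).PosSemidef

end PolySystem

/-! ### The hierarchy of semidefinite programs -/

/-- The variables `(u, v, v̂, y)` of the semidefinite programs. -/
structure SeqQuad (n : ℕ) where
  u : (Fin n →₀ ℕ) → ℝ
  v : (Fin n →₀ ℕ) → ℝ
  vHat : (Fin n →₀ ℕ) → ℝ
  y : (Fin n →₀ ℕ) → ℝ

namespace PolySystem

variable {n m : ℕ} (S : PolySystem n m)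

/-- Feasibility for the semidefinite program of order `r`. Its variables are finite vectors, which
are identified with the sequences obtained from them by completing with zeros. -/
structure SDPFeasible (r : ℕ) (s : SeqQuad n) : Prop where
  u_zero_of_lt : ∀ α, S.truncDegree r < α.degree → s.u α = 0
  v_zero_of_lt : ∀ α, 2 * r < α.degree → s.v α = 0
  vHat_zero_of_lt : ∀ α, 2 * r < α.degree → s.vHat α = 0
  y_zero_of_lt : ∀ α, 2 * r < α.degree → s.y α = 0
  mass : s.u 0 = 1
  invariant : ∀ α, α.degree ≤ 2 * r → S.invFunctional s.u (MvPolynomial.monomial α 1) = 0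
  v_add_y : ∀ α, α.degree ≤ 2 * r → s.v α + s.y α = s.u α
  v_add_vHat : ∀ α, α.degree ≤ 2 * r → s.v α + s.vHat α = momentSeq S.lebesgue α
  u_psd : S.LocPSD r s.u
  v_psd : S.LocPSD r s.v
  vHat_psd : S.LocPSD r s.vHat
  y_psd : S.LocPSD r s.y

/-- `s` is feasible and maximizes `v₀`. -/
def SDPOptimal (r : ℕ) (s : SeqQuad n) : Prop :=
  S.SDPFeasible r s ∧ ∀ s', S.SDPFeasible r s' → s'.v 0 ≤ s.v 0

/-- The optimal value `ρ^r` of the semidefinite program of order `r`. -/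
def sdpValue (r : ℕ) : EReal :=
  ⨆ (s : SeqQuad n) (_ : S.SDPFeasible r s), ((s.v 0 : ℝ) : EReal)

end PolySystem

end

end InvariantSDP

/-!
The linear program has a unique feasible first component `μ`, so its optimal value is the largest
mass of a measure below both `μ` and `λ_X`. The largest such measure is `min(1, h) λ_X`
(`le_cappedPart`), which gives the unique optimal solution.

The semidefinite programs are relaxations of the linear program (`LPFeasible.sdpFeasible`). The
ball constraint bounds all moments up to degree `2r` of a feasible point (`LocPSD.abs_moment_le`),
by constants which do not depend on `r`. The moments of `u` of degree larger than `2r` are not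
bounded, but they enter only through linear equations, so after projecting them away the feasible
set is compact (`isCompact_projectedFeasible`) and an optimal solution exists. Along an
ultrafilter, optimal solutions converge entrywise, and the limits satisfy the constraints of all
orders. By the moment problem on `X` (`IsRadius.exists_measure`) they are moment sequences of
measures, which form a feasible point of the linear program of value at least the optimal one,
hence the unique optimal solution (`tendsto_ultrafilter`). As the limit is the same for all
ultrafilters, the moments converge.

The moment problem is solved through the Krein-Milman theorem. If `L` is nonnegative on the
quadratic module of the `g_j`, then so are `p ↦ L((R ± x_i) p)`, because a functional which is
nonnegative on squares and whose moments grow at most like powers of `R` is nonnegative on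
`(R ± x_i) q²` (`ExpBounded.abs_le`). Consequently the extreme points of the set of normalized
functionals are multiplicative, i.e. evaluations at points of `X`, and every normalized functional
lies in their closed convex hull, hence in the compact convex set of moment sequences of
probability measures.

That invariance may be tested on polynomials (`IsMeasureOn.isInvariant_iff`) is the
Stone-Weierstrass theorem in discrete time. In continuous time, a compactly supported `C¹` test
function is averaged over translations against polynomial peak functions, and the derivative is
moved to the polynomial by integration by parts (`integral_fderiv_eq_zero_of_hasCompactSupport`).
-/

namespace InvariantSDP

open MvPolynomial

variable {n m : ℕ}

/-! ### The functional of a sequence -/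

/-- The functional `ℓ_y` as a linear map. -/
noncomputable def rieszHom (y : (Fin n →₀ ℕ) → ℝ) : MvPolynomial (Fin n) ℝ →ₗ[ℝ] ℝ :=
  (basisMonomials (Fin n) ℝ).constr ℝ y

lemma rieszHom_monomial (y : (Fin n →₀ ℕ) → ℝ) (α : Fin n →₀ ℕ) (c : ℝ) :
    rieszHom y (monomial α c) = c * y α := by
  have h : rieszHom y (basisMonomials (Fin n) ℝ α) = y α := Module.Basis.constr_basis _ _ _ _
  rw [coe_basisMonomials] at h
  have : monomial α c = c • (monomial α (1 : ℝ)) := by rw [smul_monomial, smul_eq_mul, mul_one]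
  rw [this, map_smul, h, smul_eq_mul]

lemma rieszHom_apply (y : (Fin n →₀ ℕ) → ℝ) (p : MvPolynomial (Fin n) ℝ) :
    rieszHom y p = riesz y p := by
  conv_lhs => rw [p.as_sum]
  rw [map_sum, riesz]
  exact Finset.sum_congr rfl fun α _ => rieszHom_monomial y α _

lemma rieszHom_one (y : (Fin n →₀ ℕ) → ℝ) : rieszHom y 1 = y 0 := by
  rw [← C_1, C_apply, rieszHom_monomial, one_mul]

/-- Every linear functional on polynomials is the functional of its moment sequence. -/
lemma rieszHom_eq (L : MvPolynomial (Fin n) ℝ →ₗ[ℝ] ℝ) :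
    rieszHom (fun α => L (monomial α 1)) = L := by
  refine (basisMonomials (Fin n) ℝ).ext fun α => ?_
  rw [coe_basisMonomials, rieszHom_monomial, one_mul]

lemma degree_le_of_mem_support {p : MvPolynomial (Fin n) ℝ} {α : Fin n →₀ ℕ}
    (h : α ∈ p.support) : α.degree ≤ p.totalDegree :=
  le_totalDegree h

lemma riesz_congr {y y' : (Fin n →₀ ℕ) → ℝ} {d : ℕ} (h : ∀ α, α.degree ≤ d → y α = y' α)
    {p : MvPolynomial (Fin n) ℝ} (hp : p.totalDegree ≤ d) : riesz y p = riesz y' p :=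
  Finset.sum_congr rfl fun α hα => by rw [h α ((degree_le_of_mem_support hα).trans hp)]

lemma continuous_riesz (p : MvPolynomial (Fin n) ℝ) :
    Continuous fun y : (Fin n →₀ ℕ) → ℝ => riesz y p := by
  unfold riesz
  fun_prop

lemma tendsto_riesz {ι : Type*} {l : Filter ι} {y : ι → (Fin n →₀ ℕ) → ℝ} {y₀ : (Fin n →₀ ℕ) → ℝ}
    (h : ∀ α, Tendsto (fun k => y k α) l (𝓝 (y₀ α))) (p : MvPolynomial (Fin n) ℝ) :
    Tendsto (fun k => riesz (y k) p) l (𝓝 (riesz y₀ p)) :=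
  ((continuous_riesz p).tendsto y₀).comp (tendsto_pi_nhds.2 h)

/-! ### Localizing matrices as conditions on squares -/

/-- A localizing matrix is positive semidefinite iff the functional is nonnegative on the products
of `g` with squares of polynomials of bounded degree. -/
lemma locMatrix_posSemidef_iff (s : ℕ) (g : MvPolynomial (Fin n) ℝ) (y : (Fin n →₀ ℕ) → ℝ) :
    (locMatrix s g y).PosSemidef ↔
      ∀ q : MvPolynomial (Fin n) ℝ, q.totalDegree ≤ s → 0 ≤ riesz y (g * q ^ 2) := by
  have key : ∀ x : {β : Fin n →₀ ℕ // β.degree ≤ s} →₀ ℝ,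
      (x.sum fun i xi => x.sum fun j xj => star xi * locMatrix s g y i j * xj) =
        riesz y (g * (∑ i ∈ x.support, monomial i.1 (x i)) ^ 2) := by
    intro x
    rw [pow_two, Finset.sum_mul_sum, Finset.mul_sum, ← rieszHom_apply, map_sum, Finsupp.sum]
    refine Finset.sum_congr rfl fun i _ => ?_
    rw [Finset.mul_sum, map_sum, Finsupp.sum]
    refine Finset.sum_congr rfl fun j _ => ?_
    have : g * (monomial i.1 (x i) * monomial j.1 (x j)) =
        (x i * x j) • (g * monomial (i.1 + j.1) (1 : ℝ)) := by
      rw [monomial_mul, ← mul_smul_comm, smul_monomial, smul_eq_mul, mul_one]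
    rw [this, map_smul, rieszHom_apply, smul_eq_mul, star_trivial, locMatrix, Matrix.of_apply]
    ring
  constructor
  · intro h q hq
    classical
    let x : {β : Fin n →₀ ℕ // β.degree ≤ s} →₀ ℝ :=
      Finsupp.onFinset (q.support.subtype fun β => β.degree ≤ s) (fun i => q.coeff i.1)
        (fun i hi => by simpa [Finset.mem_subtype] using hi)
    have hx : ∑ i ∈ x.support, monomial i.1 (x i) = q := by
      conv_rhs => rw [q.as_sum]
      have h1 : ∑ i ∈ x.support, monomial i.1 (x i) =
          ∑ i ∈ q.support.subtype (fun β => β.degree ≤ s), monomial i.1 (q.coeff i.1) := by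
        refine Finset.sum_subset_zero_on_sdiff Finsupp.support_onFinset_subset ?_ ?_
        · intro i hi
          have : x i = 0 := Finsupp.notMem_support_iff.1 (Finset.mem_sdiff.1 hi).2
          change q.coeff i.1 = 0 at this
          rw [this, monomial_zero]
        · intro i _
          rfl
      rw [h1, Finset.sum_subtype_of_mem (fun β => monomial β (q.coeff β))]
      intro β hβ
      exact (degree_le_of_mem_support hβ).trans hq
    rw [← hx, ← key]
    exact h.2 x
  · intro h
    refine ⟨?_, fun x => ?_⟩
    · ext i j
      simp [locMatrix, add_comm]
    · rw [key]
      refine h _ (totalDegree_finsetSum_le fun i _ => ?_)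
      exact (totalDegree_monomial_le _ _).trans i.2

/-- The constraints `LocPSD` of order `r` in terms of squares. -/
lemma PolySystem.locPSD_iff (S : PolySystem n m) (r : ℕ) (y : (Fin n →₀ ℕ) → ℝ) :
    S.LocPSD r y ↔
      (∀ q : MvPolynomial (Fin n) ℝ, q.totalDegree ≤ r → 0 ≤ riesz y (q ^ 2)) ∧
      ∀ j, ∀ q : MvPolynomial (Fin n) ℝ, q.totalDegree ≤ r - halfDeg (S.g j) →
        0 ≤ riesz y (S.g j * q ^ 2) := by
  simp only [LocPSD, locMatrix_posSemidef_iff, one_mul]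

lemma PolySystem.halfDeg_le_rMin (S : PolySystem n m) (j : Fin m) :
    halfDeg (S.g j) ≤ S.rMin :=
  le_max_of_le_right (Finset.le_sup (f := fun j => halfDeg (S.g j)) (Finset.mem_univ j))

/-- For `r ≥ r_min` the constraints `LocPSD` involve only the moments up to degree `2r`. -/
lemma PolySystem.LocPSD.congr {S : PolySystem n m} {r : ℕ} (hr : S.rMin ≤ r)
    {y y' : (Fin n →₀ ℕ) → ℝ} (h : ∀ α, α.degree ≤ 2 * r → y α = y' α) (hy : S.LocPSD r y) :
    S.LocPSD r y' := by
  rw [S.locPSD_iff] at hy ⊢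
  refine ⟨fun q hq => ?_, fun j q hq => ?_⟩
  · rw [← riesz_congr h]
    · exact hy.1 q hq
    · exact (totalDegree_pow _ _).trans (by omega)
  · rw [← riesz_congr h]
    · exact hy.2 j q hq
    · have h1 := (S.halfDeg_le_rMin j).trans hr
      have h2 := totalDegree_mul (S.g j) (q ^ 2)
      have h3 := totalDegree_pow q 2
      unfold halfDeg at h1 hq
      omega

lemma PolySystem.isClosed_locPSD (S : PolySystem n m) (r : ℕ) : IsClosed {y | S.LocPSD r y} := by
  simp only [S.locPSD_iff, Set.ofPred_and, Set.ofPred_forall]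
  refine IsClosed.inter ?_ ?_
  · exact isClosed_iInter fun q => isClosed_iInter fun _ =>
      isClosed_le continuous_const (continuous_riesz _)
  · exact isClosed_iInter fun j => isClosed_iInter fun q => isClosed_iInter fun _ =>
      isClosed_le continuous_const (continuous_riesz _)

/-- The Cauchy-Schwarz inequality for a functional which is nonnegative on the squares of the
polynomials `p + t q`. -/
lemma sq_le_mul_of_nonneg_sq {L : MvPolynomial (Fin n) ℝ →ₗ[ℝ] ℝ} {p q : MvPolynomial (Fin n) ℝ}
    (h : ∀ t : ℝ, 0 ≤ L ((p + t • q) ^ 2)) : L (p * q) ^ 2 ≤ L (p ^ 2) * L (q ^ 2) := by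
  have h1 : ∀ t : ℝ, 0 ≤ L (q ^ 2) * (t * t) + (2 * L (p * q)) * t + L (p ^ 2) := by
    intro t
    have : (p + t • q) ^ 2 = (t * t) • q ^ 2 + (2 * t) • (p * q) + p ^ 2 := by
      simp only [smul_eq_C_mul, map_mul, map_ofNat]
      ring
    have h2 := h t
    rw [this, map_add, map_add, map_smul, map_smul, smul_eq_mul, smul_eq_mul] at h2
    linarith
  have := discrim_le_zero h1
  unfold discrim at this
  nlinarith

/-! ### Moment bounds from the ball constraint -/

/-- `R` is a radius for `S` if `R ≥ 1` and the ball constraint of `S` has radius at most `R`. -/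
def PolySystem.IsRadius (S : PolySystem n m) (R : ℝ) : Prop :=
  1 ≤ R ∧ ∃ (N : ℝ) (j : Fin m), N ≤ R ^ 2 ∧ S.g j = C N - ∑ i, MvPolynomial.X i ^ 2

lemma PolySystem.Archimedean.exists_isRadius {S : PolySystem n m} (hS : S.Archimedean) :
    ∃ R, S.IsRadius R := by
  obtain ⟨N, j, hj⟩ := hS
  refine ⟨max 1 N, le_max_left _ _, N, j, ?_, hj⟩
  have h1 := le_max_left (1 : ℝ) N
  have h2 := le_max_right (1 : ℝ) N
  nlinarith

lemma PolySystem.IsRadius.pos {S : PolySystem n m} {R : ℝ} (hR : S.IsRadius R) : 0 < R :=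
  one_pos.trans_le hR.1

lemma PolySystem.IsRadius.abs_coord_le {S : PolySystem n m} {R : ℝ} (hR : S.IsRadius R)
    {x : Fin n → ℝ} (hx : x ∈ S.X) (i : Fin n) : |x i| ≤ R := by
  obtain ⟨h1, N, j, hN, hj⟩ := hR
  have h := hx j
  rw [hj] at h
  simp only [map_sub, eval_C, map_sum, map_pow, eval_X] at h
  have h2 : x i ^ 2 ≤ ∑ i, x i ^ 2 :=
    Finset.single_le_sum (f := fun i => x i ^ 2) (fun i _ => sq_nonneg _) (Finset.mem_univ i)
  exact abs_le_of_sq_le_sq (by linarith) (by linarith)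

lemma halfDeg_ball_le (N : ℝ) : halfDeg (C N - ∑ i, X i ^ 2 : MvPolynomial (Fin n) ℝ) ≤ 1 := by
  have h1 : (∑ i, X i ^ 2 : MvPolynomial (Fin n) ℝ).totalDegree ≤ 2 :=
    totalDegree_finsetSum_le fun i _ => (totalDegree_pow _ _).trans (by rw [totalDegree_X])
  have h2 := totalDegree_sub (C N : MvPolynomial (Fin n) ℝ) (∑ i, X i ^ 2)
  rw [totalDegree_C] at h2
  unfold halfDeg
  omega

lemma monomial_one_sq (β : Fin n →₀ ℕ) :
    (monomial β (1 : ℝ)) ^ 2 = monomial (2 • β) 1 := by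
  rw [monomial_pow, one_pow]

/-- The even moments of order at most `2r` grow at most geometrically. -/
lemma PolySystem.LocPSD.even_moment_le {S : PolySystem n m} {R : ℝ} (hR : S.IsRadius R) {r : ℕ}
    {y : (Fin n →₀ ℕ) → ℝ} (hy : S.LocPSD r y) (k : ℕ) :
    ∀ β : Fin n →₀ ℕ, β.degree = k → k ≤ r → y (2 • β) ≤ (R ^ 2) ^ k * y 0 := by
  obtain ⟨-, N, j, hN, hj⟩ := hR
  rw [S.locPSD_iff] at hy
  have nonneg : ∀ γ : Fin n →₀ ℕ, γ.degree ≤ r → 0 ≤ y (2 • γ) := by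
    intro γ hγ
    have := hy.1 (monomial γ 1) ((totalDegree_monomial_le _ _).trans hγ)
    rwa [monomial_one_sq, ← rieszHom_apply, rieszHom_monomial, one_mul] at this
  induction k with
  | zero =>
    intro β hβ _
    rw [Finsupp.degree_eq_zero_iff] at hβ
    simp [hβ]
  | succ k ih =>
    intro β hβ hk
    obtain ⟨i, hi⟩ : ∃ i, β i ≠ 0 := by
      by_contra! h
      have : β = 0 := Finsupp.ext h
      simp [this] at hβ
    obtain ⟨γ, rfl⟩ : ∃ γ, β = γ + Finsupp.single i 1 := by
      refine ⟨β - Finsupp.single i 1, (tsub_add_cancel_of_le ?_).symm⟩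
      rw [Finsupp.single_le_iff]
      omega
    have hγ : γ.degree = k := by
      rw [map_add, Finsupp.degree_single] at hβ
      omega
    have h1 := hy.2 j (monomial γ 1) ((totalDegree_monomial_le _ _).trans (by
      have := halfDeg_ball_le (n := n) N
      rw [← hj] at this
      change γ.degree ≤ _
      omega))
    have h2 : S.g j * (monomial γ (1 : ℝ)) ^ 2 =
        monomial (2 • γ) N - ∑ l, monomial (2 • (γ + Finsupp.single l 1)) 1 := by
      rw [hj, sub_mul, monomial_one_sq, C_mul_monomial, mul_one, Finset.sum_mul]
      congr 1
      refine Finset.sum_congr rfl fun l _ => ?_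
      rw [MvPolynomial.X, monomial_one_sq, monomial_mul, one_mul, smul_add, add_comm]
    rw [h2, ← rieszHom_apply, map_sub, map_sum, rieszHom_monomial] at h1
    simp only [rieszHom_monomial, one_mul] at h1
    have h3 : y (2 • (γ + Finsupp.single i 1)) ≤ ∑ l, y (2 • (γ + Finsupp.single l 1)) :=
      Finset.single_le_sum (f := fun l => y (2 • (γ + Finsupp.single l 1)))
        (fun l _ => nonneg _ (by rw [map_add, Finsupp.degree_single]; omega)) (Finset.mem_univ i)
    have h4 := ih γ hγ (by omega)
    have h5 := nonneg γ (by omega)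
    calc y (2 • (γ + Finsupp.single i 1)) ≤ N * y (2 • γ) := by linarith
      _ ≤ R ^ 2 * y (2 • γ) := by gcongr
      _ ≤ R ^ 2 * ((R ^ 2) ^ k * y 0) := by gcongr
      _ = (R ^ 2) ^ (k + 1) * y 0 := by ring

/-- The moments of order at most `2r` grow at most geometrically. -/
lemma PolySystem.LocPSD.abs_moment_le {S : PolySystem n m} {R : ℝ} (hR : S.IsRadius R) {r : ℕ}
    {y : (Fin n →₀ ℕ) → ℝ} (hy : S.LocPSD r y) {α : Fin n →₀ ℕ} (hα : α.degree ≤ 2 * r) :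
    |y α| ≤ R ^ α.degree * y 0 := by
  have hy' := S.locPSD_iff r y |>.1 hy
  have h0 : 0 ≤ y 0 := by
    have := hy'.1 1 (by simp)
    rwa [one_pow, ← rieszHom_apply, rieszHom_one] at this
  obtain ⟨β, hβα, hβ⟩ := α.exists_le_degree_eq (min r α.degree) (min_le_right _ _)
  obtain ⟨γ, rfl⟩ := exists_add_of_le hβα
  rw [map_add] at hα hβ ⊢
  have hβr : β.degree ≤ r := by omega
  have hγr : γ.degree ≤ r := by omega
  have cs := sq_le_mul_of_nonneg_sq (L := rieszHom y) (p := monomial β 1) (q := monomial γ 1)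
    fun t => by
      rw [rieszHom_apply]
      refine hy'.1 _ ((totalDegree_add _ _).trans (max_le ?_ ?_))
      · exact (totalDegree_monomial_le _ _).trans hβr
      · exact (totalDegree_smul_le _ _).trans ((totalDegree_monomial_le _ _).trans hγr)
  rw [monomial_mul, monomial_one_sq, monomial_one_sq, rieszHom_monomial, rieszHom_monomial,
    rieszHom_monomial] at cs
  simp only [one_mul] at cs
  have e1 := hy.even_moment_le hR _ β rfl hβr
  have e2 := hy.even_moment_le hR _ γ rfl hγr
  have n2 : 0 ≤ y (2 • γ) := by
    have := hy'.1 (monomial γ 1) ((totalDegree_monomial_le _ _).trans hγr)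
    rwa [monomial_one_sq, ← rieszHom_apply, rieszHom_monomial, one_mul] at this
  have hRp := hR.pos
  refine abs_le_of_sq_le_sq ?_ (by positivity)
  calc y (β + γ) ^ 2 ≤ y (2 • β) * y (2 • γ) := cs
    _ ≤ ((R ^ 2) ^ β.degree * y 0) * ((R ^ 2) ^ γ.degree * y 0) := by gcongr
    _ = (R ^ (β.degree + γ.degree) * y 0) ^ 2 := by ring

/-! ### Multiplication by `R ± x_i` preserves positivity -/

/-- The moments of `L` grow at most like powers of `R`. -/
def ExpBounded (R : ℝ) (L : MvPolynomial (Fin n) ℝ →ₗ[ℝ] ℝ) : Prop :=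
  ∃ c, ∀ α : Fin n →₀ ℕ, |L (monomial α 1)| ≤ c * R ^ α.degree

/-- The functional `q ↦ L(p q)`. -/
noncomputable def mulFunctional (L : MvPolynomial (Fin n) ℝ →ₗ[ℝ] ℝ) (p : MvPolynomial (Fin n) ℝ) :
    MvPolynomial (Fin n) ℝ →ₗ[ℝ] ℝ :=
  L ∘ₗ LinearMap.mulLeft ℝ p

@[simp] lemma mulFunctional_apply (L : MvPolynomial (Fin n) ℝ →ₗ[ℝ] ℝ)
    (p q : MvPolynomial (Fin n) ℝ) : mulFunctional L p q = L (p * q) := rfl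

lemma ExpBounded.mulFunctional {R : ℝ} {L : MvPolynomial (Fin n) ℝ →ₗ[ℝ] ℝ} (h : ExpBounded R L)
    (p : MvPolynomial (Fin n) ℝ) : ExpBounded R (mulFunctional L p) := by
  obtain ⟨c, hc⟩ := h
  refine ⟨∑ β ∈ p.support, |p.coeff β| * (c * R ^ β.degree), fun α => ?_⟩
  have : p * monomial α 1 = ∑ β ∈ p.support, p.coeff β • monomial (β + α) (1 : ℝ) := by
    conv_lhs => rw [p.as_sum]
    rw [Finset.sum_mul]
    refine Finset.sum_congr rfl fun β _ => ?_
    rw [monomial_mul, smul_monomial, smul_eq_mul]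
  rw [mulFunctional_apply, this, map_sum, Finset.sum_mul]
  refine (Finset.abs_sum_le_sum_abs _ _).trans (Finset.sum_le_sum fun β _ => ?_)
  rw [map_smul, smul_eq_mul, abs_mul, mul_assoc, mul_assoc, ← pow_add, ← map_add]
  gcongr
  exact hc _

/-- A functional which is nonnegative on squares and whose moments grow at most like powers of `R`
is nonnegative on the squares times `R ± x_i`: the Cauchy-Schwarz inequality is iterated along
`L(x_i q²), L(x_i² q²), L(x_i⁴ q²), …`. -/
lemma ExpBounded.abs_le {R : ℝ} (hR : 0 < R) {L : MvPolynomial (Fin n) ℝ →ₗ[ℝ] ℝ}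
    (h : ExpBounded R L) (hL : ∀ q, 0 ≤ L (q ^ 2)) (i : Fin n) (q : MvPolynomial (Fin n) ℝ) :
    |L (X i * q ^ 2)| ≤ R * L (q ^ 2) := by
  obtain ⟨c, hc⟩ := h.mulFunctional (q ^ 2)
  set a : ℕ → ℝ := fun k => L (X i ^ k * q ^ 2) with ha
  have bound : ∀ k, |a k| ≤ c * R ^ k := by
    intro k
    have := hc (Finsupp.single i k)
    rwa [mulFunctional_apply, Finsupp.degree_single, ← X_pow_eq_monomial, mul_comm] at this
  have cs : ∀ k, a k ^ 2 ≤ a 0 * a (2 * k) := by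
    intro k
    have := sq_le_mul_of_nonneg_sq (L := L) (p := q) (q := X i ^ k * q) fun t => hL _
    have e1 : q * (X i ^ k * q) = X i ^ k * q ^ 2 := by ring
    have e2 : (X i ^ k * q) ^ 2 = X i ^ (2 * k) * q ^ 2 := by ring
    rw [e1, e2] at this
    simpa [ha] using this
  have h0 : 0 ≤ a 0 := by simpa [ha] using hL q
  have goal : |a 1| ≤ R * a 0 := by
    rcases h0.eq_or_lt with h00 | h00
    · have := cs 1
      rw [← h00, zero_mul] at this
      have : a 1 = 0 := by nlinarith
      simp [this, ← h00]
    · by_contra! hlt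
      -- the normalized moments `b k` satisfy `b 1 ^ (2 ^ k) ≤ b (2 ^ k)` and are bounded
      set t := |a 1| / (R * a 0) with ht
      have ht1 : 1 < t := by rw [ht, one_lt_div (by positivity)]; exact hlt
      have hpow : ∀ k : ℕ, t ^ 2 ^ k * (a 0 * R ^ 2 ^ k) ≤ |a (2 ^ k)| := by
        intro k
        induction k with
        | zero =>
          simp only [pow_zero, pow_one, ht]
          field_simp
          exact le_rfl
        | succ k ih =>
          have h1 := cs (2 ^ k)
          rw [← pow_succ'] at h1
          have h2 : (t ^ 2 ^ k * (a 0 * R ^ 2 ^ k)) ^ 2 ≤ a 0 * |a (2 ^ (k + 1))| := by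
            calc _ ≤ |a (2 ^ k)| ^ 2 := by gcongr
              _ = a (2 ^ k) ^ 2 := sq_abs _
              _ ≤ a 0 * a (2 ^ (k + 1)) := h1
              _ ≤ _ := by gcongr; exact le_abs_self _
          have h3 : (t ^ 2 ^ k * (a 0 * R ^ 2 ^ k)) ^ 2 =
              a 0 * (t ^ 2 ^ (k + 1) * (a 0 * R ^ 2 ^ (k + 1))) := by
            rw [pow_succ 2 k, pow_mul, pow_mul]; ring
          rw [h3] at h2
          exact le_of_mul_le_mul_left h2 h00
      have hbd : ∀ k : ℕ, t ^ 2 ^ k ≤ c / a 0 := by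
        intro k
        rw [le_div_iff₀ h00]
        have h1 := (hpow k).trans (bound _)
        rw [← mul_assoc] at h1
        exact le_of_mul_le_mul_right h1 (by positivity)
      have hlim := (tendsto_pow_atTop_atTop_of_one_lt ht1).comp
        (tendsto_pow_atTop_atTop_of_one_lt (one_lt_two : (1 : ℕ) < 2))
      obtain ⟨k, hk⟩ := (hlim.eventually_gt_atTop (c / a 0)).exists
      exact absurd (hbd k) (not_le.2 hk)
  simpa [ha] using goal

/-! ### Measures on the semialgebraic set -/

lemma PolySystem.isClosed_X (S : PolySystem n m) : IsClosed S.X := by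
  have : S.X = ⋂ j, {x | 0 ≤ MvPolynomial.eval x (S.g j)} := by
    ext x
    simp [PolySystem.X]
  rw [this]
  exact isClosed_iInter fun j => isClosed_le continuous_const (continuous_eval _)

lemma PolySystem.IsRadius.isCompact {S : PolySystem n m} {R : ℝ} (hR : S.IsRadius R) :
    IsCompact S.X := by
  refine (isCompact_univ_pi fun _ : Fin n => isCompact_Icc (a := -R) (b := R)).of_isClosed_subset
    S.isClosed_X fun x hx i _ => ?_
  exact abs_le.1 (hR.abs_coord_le hx i)

lemma PolySystem.IsMeasureOn.ae_mem {S : PolySystem n m} {μ : Measure (Fin n → ℝ)}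
    (h : S.IsMeasureOn μ) : ∀ᵐ x ∂μ, x ∈ S.X :=
  h.2

lemma PolySystem.IsMeasureOn.restrict_eq {S : PolySystem n m} {μ : Measure (Fin n → ℝ)}
    (h : S.IsMeasureOn μ) : μ.restrict S.X = μ :=
  Measure.restrict_eq_self_of_ae_mem h.ae_mem

lemma PolySystem.IsMeasureOn.integrable {S : PolySystem n m} (hX : IsCompact S.X)
    {μ : Measure (Fin n → ℝ)} (h : S.IsMeasureOn μ) {f : (Fin n → ℝ) → ℝ}
    (hf : Continuous f) : Integrable f μ := by
  have := h.1
  have h1 : IntegrableOn f S.X μ := hf.continuousOn.integrableOn_compact hX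
  rwa [IntegrableOn, h.restrict_eq] at h1

lemma eval_monomial_one (x : Fin n → ℝ) (α : Fin n →₀ ℕ) :
    eval x (monomial α (1 : ℝ)) = ∏ i, x i ^ α i := by
  rw [eval_monomial, one_mul, Finsupp.prod_fintype _ _ fun i => pow_zero _]

lemma continuous_monomial (α : Fin n →₀ ℕ) : Continuous fun x : Fin n → ℝ => ∏ i, x i ^ α i := by
  fun_prop

lemma PolySystem.IsMeasureOn.riesz_momentSeq {S : PolySystem n m} (hX : IsCompact S.X)
    {μ : Measure (Fin n → ℝ)} (h : S.IsMeasureOn μ) (p : MvPolynomial (Fin n) ℝ) :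
    riesz (momentSeq μ) p = ∫ x, eval x p ∂μ := by
  have : ∀ x, eval x p = ∑ α ∈ p.support, p.coeff α * ∏ i, x i ^ α i := fun x => eval_eq' x p
  simp_rw [this]
  rw [integral_finsetSum _ fun α _ => (h.integrable hX (continuous_monomial α)).const_mul _, riesz]
  refine Finset.sum_congr rfl fun α _ => ?_
  rw [integral_const_mul, momentSeq]

lemma PolySystem.IsMeasureOn.locPSD {S : PolySystem n m} (hX : IsCompact S.X)
    {μ : Measure (Fin n → ℝ)} (h : S.IsMeasureOn μ) (r : ℕ) : S.LocPSD r (momentSeq μ) := by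
  rw [S.locPSD_iff]
  refine ⟨fun q _ => ?_, fun j q _ => ?_⟩
  · rw [h.riesz_momentSeq hX]
    refine integral_nonneg fun x => ?_
    simp only [map_pow]
    positivity
  · rw [h.riesz_momentSeq hX]
    refine integral_nonneg_of_ae ?_
    filter_upwards [h.ae_mem] with x hx
    rw [map_mul, map_pow]
    exact mul_nonneg (hx j) (sq_nonneg _)

lemma momentSeq_zero_eq (μ : Measure (Fin n → ℝ)) : momentSeq μ 0 = μ.real Set.univ := by
  simp [momentSeq]

/-! ### The moment problem on the semialgebraic set -/

/-- `L` is nonnegative on the quadratic module generated by `g₁, …, g_m`. -/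
def PolySystem.IsPos (S : PolySystem n m) (L : MvPolynomial (Fin n) ℝ →ₗ[ℝ] ℝ) : Prop :=
  (∀ q, 0 ≤ L (q ^ 2)) ∧ ∀ j q, 0 ≤ L (S.g j * q ^ 2)

lemma PolySystem.isPos_rieszHom_iff (S : PolySystem n m) (y : (Fin n →₀ ℕ) → ℝ) :
    S.IsPos (rieszHom y) ↔ ∀ r, S.LocPSD r y := by
  simp only [IsPos, rieszHom_apply, S.locPSD_iff]
  refine ⟨fun h r => ⟨fun q _ => h.1 q, fun j q _ => h.2 j q⟩,
    fun h => ⟨fun q => ?_, fun j q => ?_⟩⟩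
  · exact (h q.totalDegree).1 q le_rfl
  · exact (h (q.totalDegree + halfDeg (S.g j))).2 j q (by omega)

lemma PolySystem.IsPos.abs_moment_le {S : PolySystem n m} {R : ℝ} (hR : S.IsRadius R)
    {L : MvPolynomial (Fin n) ℝ →ₗ[ℝ] ℝ} (h : S.IsPos L) (α : Fin n →₀ ℕ) :
    |L (monomial α 1)| ≤ R ^ α.degree * L 1 := by
  rw [← rieszHom_eq L, S.isPos_rieszHom_iff] at h
  exact (h α.degree).abs_moment_le hR (by omega)

lemma PolySystem.IsPos.expBounded {S : PolySystem n m} {R : ℝ} (hR : S.IsRadius R)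
    {L : MvPolynomial (Fin n) ℝ →ₗ[ℝ] ℝ} (h : S.IsPos L) : ExpBounded R L :=
  ⟨L 1, fun α => (h.abs_moment_le hR α).trans_eq (mul_comm _ _)⟩

lemma PolySystem.IsPos.eq_zero {S : PolySystem n m} {R : ℝ} (hR : S.IsRadius R)
    {L : MvPolynomial (Fin n) ℝ →ₗ[ℝ] ℝ} (h : S.IsPos L) (h1 : L 1 = 0) : L = 0 := by
  refine (basisMonomials (Fin n) ℝ).ext fun α => ?_
  have := h.abs_moment_le hR α
  rw [h1, mul_zero] at this
  rw [coe_basisMonomials]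
  exact abs_eq_zero.1 (this.antisymm (abs_nonneg _))

lemma PolySystem.IsPos.smul {S : PolySystem n m} {L : MvPolynomial (Fin n) ℝ →ₗ[ℝ] ℝ}
    (h : S.IsPos L) {c : ℝ} (hc : 0 ≤ c) : S.IsPos (c • L) :=
  ⟨fun q => mul_nonneg hc (h.1 q), fun j q => mul_nonneg hc (h.2 j q)⟩

/-- If `L` is nonnegative on the quadratic module, so is `p ↦ L((R ± x_i) p)`. -/
lemma PolySystem.IsPos.mulFunctional {S : PolySystem n m} {R : ℝ} (hR : S.IsRadius R)
    {L : MvPolynomial (Fin n) ℝ →ₗ[ℝ] ℝ} (h : S.IsPos L) (i : Fin n) {ε : ℝ} (hε : |ε| = 1) :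
    S.IsPos (mulFunctional L (C R + C ε * MvPolynomial.X i)) := by
  have key : ∀ M : MvPolynomial (Fin n) ℝ →ₗ[ℝ] ℝ, ExpBounded R M → (∀ q, 0 ≤ M (q ^ 2)) →
      ∀ q, 0 ≤ M ((C R + C ε * MvPolynomial.X i) * q ^ 2) := by
    intro M hM hM' q
    have h1 := hM.abs_le hR.pos hM' i q
    rw [add_mul, mul_assoc, ← smul_eq_C_mul, ← smul_eq_C_mul, map_add, map_smul, map_smul,
      smul_eq_mul, smul_eq_mul]
    have h2 : |ε * M (MvPolynomial.X i * q ^ 2)| ≤ R * M (q ^ 2) := by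
      rwa [abs_mul, hε, one_mul]
    linarith [neg_abs_le (ε * M (MvPolynomial.X i * q ^ 2))]
  refine ⟨fun q => key L (h.expBounded hR) h.1 q, fun j q => ?_⟩
  have := key (InvariantSDP.mulFunctional L (S.g j)) ((h.expBounded hR).mulFunctional _)
    (fun q => h.2 j q) q
  rw [mulFunctional_apply] at this ⊢
  rwa [mul_left_comm]

/-- The normalized sequences satisfying the constraints of all orders. -/
def PolySystem.stateSpace (S : PolySystem n m) : Set ((Fin n →₀ ℕ) → ℝ) :=
  {y | y 0 = 1 ∧ ∀ r, S.LocPSD r y}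

lemma PolySystem.mem_stateSpace_iff (S : PolySystem n m) (y : (Fin n →₀ ℕ) → ℝ) :
    y ∈ S.stateSpace ↔ y 0 = 1 ∧ S.IsPos (rieszHom y) := by
  rw [S.isPos_rieszHom_iff]
  rfl

lemma PolySystem.IsRadius.isCompact_stateSpace {S : PolySystem n m} {R : ℝ} (hR : S.IsRadius R) :
    IsCompact S.stateSpace := by
  have hclosed : IsClosed S.stateSpace := by
    have : S.stateSpace = {y | y 0 = 1} ∩ ⋂ r, {y | S.LocPSD r y} := by
      ext y
      simp [stateSpace]
    rw [this]
    exact (isClosed_eq (continuous_apply 0) continuous_const).inter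
      (isClosed_iInter fun r => S.isClosed_locPSD r)
  refine (isCompact_univ_pi fun α : Fin n →₀ ℕ =>
    isCompact_Icc (a := -R ^ α.degree) (b := R ^ α.degree)).of_isClosed_subset hclosed
      fun y hy α _ => ?_
  have := (hy.2 α.degree).abs_moment_le hR (α := α) (by omega)
  rw [hy.1, mul_one] at this
  exact abs_le.1 this

lemma PolySystem.convex_stateSpace (S : PolySystem n m) : Convex ℝ S.stateSpace := by
  intro y hy z hz a b ha hb hab
  rw [mem_stateSpace_iff] at hy hz ⊢
  have e : rieszHom (a • y + b • z) = a • rieszHom y + b • rieszHom z := by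
    simp [rieszHom, map_add, map_smul]
  refine ⟨by simp [hy.1, hz.1, hab], ?_⟩
  rw [e]
  exact ⟨fun q => add_nonneg (mul_nonneg ha (hy.2.1 q)) (mul_nonneg hb (hz.2.1 q)),
    fun j q => add_nonneg (mul_nonneg ha (hy.2.2 j q)) (mul_nonneg hb (hz.2.2 j q))⟩

/-- Extreme points of the state space are multiplicative: `L` is a convex combination of the
normalizations of `L((R + x_i) ·)` and `L((R - x_i) ·)`. -/
lemma PolySystem.IsRadius.map_X_mul {S : PolySystem n m} {R : ℝ} (hR : S.IsRadius R)
    {y : (Fin n →₀ ℕ) → ℝ} (hy : y ∈ Set.extremePoints ℝ S.stateSpace) (i : Fin n)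
    (p : MvPolynomial (Fin n) ℝ) :
    rieszHom y (MvPolynomial.X i * p) = rieszHom y (MvPolynomial.X i) * rieszHom y p := by
  obtain ⟨hyK, hext⟩ := hy
  obtain ⟨hy0, hpos⟩ := (S.mem_stateSpace_iff y).1 hyK
  set L := rieszHom y with hL
  have hL1 : L 1 = 1 := by rw [hL, rieszHom_one, hy0]
  set A := InvariantSDP.mulFunctional L (C R + C 1 * MvPolynomial.X i) with hA
  set B := InvariantSDP.mulFunctional L (C R + C (-1) * MvPolynomial.X i) with hB
  have hApos : S.IsPos A := hpos.mulFunctional hR i (by simp)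
  have hBpos : S.IsPos B := hpos.mulFunctional hR i (by simp)
  have eA : ∀ q, A q = R * L q + L (MvPolynomial.X i * q) := by
    intro q
    rw [hA, mulFunctional_apply, C_1, one_mul, add_mul, ← smul_eq_C_mul, map_add, map_smul,
      smul_eq_mul]
  have eB : ∀ q, B q = R * L q - L (MvPolynomial.X i * q) := by
    intro q
    rw [hB, mulFunctional_apply, add_mul, mul_assoc, ← smul_eq_C_mul, ← smul_eq_C_mul, map_add,
      map_smul, map_smul, smul_eq_mul, smul_eq_mul]
    ring
  have eA1 := eA 1
  have eB1 := eB 1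
  rw [mul_one, hL1, mul_one] at eA1 eB1
  have hA1 : 0 ≤ A 1 := by simpa using hApos.1 1
  have hB1 : 0 ≤ B 1 := by simpa using hBpos.1 1
  -- if `A 1` or `B 1` vanishes, so does `A` or `B`, and `L(x_i p) = ∓R L(p)`
  rcases hA1.eq_or_lt with hA0 | hA0
  · have h0 := hApos.eq_zero hR hA0.symm
    have h1 := eA p
    rw [h0, LinearMap.zero_apply] at h1 eA1
    have : L (MvPolynomial.X i) = -R := by linarith
    rw [this]
    linarith
  rcases hB1.eq_or_lt with hB0 | hB0
  · have h0 := hBpos.eq_zero hR hB0.symm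
    have h1 := eB p
    rw [h0, LinearMap.zero_apply] at h1 eB1
    have : L (MvPolynomial.X i) = R := by linarith
    rw [this]
    linarith
  -- otherwise `2R L = A + B` exhibits `L` as a proper convex combination, so `A = (A 1) L`
  have mem : ∀ M : MvPolynomial (Fin n) ℝ →ₗ[ℝ] ℝ, S.IsPos M → 0 < M 1 →
      (fun α => ((M 1)⁻¹ • M) (monomial α 1)) ∈ S.stateSpace := by
    intro M hM hM1
    rw [S.mem_stateSpace_iff, rieszHom_eq]
    refine ⟨?_, hM.smul (inv_nonneg.2 hM1.le)⟩
    change (M 1)⁻¹ * M 1 = 1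
    exact inv_mul_cancel₀ hM1.ne'
  have hRp := hR.pos
  have hyA := hext (mem A hApos hA0) (mem B hBpos hB0)
    ⟨A 1 / (2 * R), B 1 / (2 * R), by positivity, by positivity, by
      rw [eA1, eB1]; field_simp; ring, by
      ext α
      have e : L (monomial α 1) = y α := by rw [hL, rieszHom_monomial, one_mul]
      simp only [Pi.add_apply, Pi.smul_apply, LinearMap.smul_apply, smul_eq_mul]
      have h1 : A 1 / (2 * R) * ((A 1)⁻¹ * A (monomial α 1)) = A (monomial α 1) / (2 * R) := by
        field_simp
      have h2 : B 1 / (2 * R) * ((B 1)⁻¹ * B (monomial α 1)) = B (monomial α 1) / (2 * R) := by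
        field_simp
      rw [h1, h2, eA, eB, ← e]
      field_simp
      ring⟩
  have hLA : (A 1)⁻¹ • A = L := by
    rw [hL, ← hyA, rieszHom_eq]
  have h1 : A p = A 1 * L p := by
    rw [← hLA, LinearMap.smul_apply, smul_eq_mul, mul_inv_cancel_left₀ hA0.ne']
  rw [eA, eA1] at h1
  linarith

/-- The extreme points of the state space are the moment sequences of points of `X`. -/
lemma PolySystem.IsRadius.exists_eval_of_mem_extremePoints {S : PolySystem n m} {R : ℝ}
    (hR : S.IsRadius R) {y : (Fin n →₀ ℕ) → ℝ} (hy : y ∈ Set.extremePoints ℝ S.stateSpace) :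
    ∃ x ∈ S.X, ∀ α, y α = ∏ i, x i ^ α i := by
  obtain ⟨hy0, hpos⟩ := (S.mem_stateSpace_iff y).1 hy.1
  set x : Fin n → ℝ := fun i => rieszHom y (MvPolynomial.X i) with hx
  have key : ∀ p, rieszHom y p = MvPolynomial.eval x p := by
    intro p
    induction p using MvPolynomial.induction_on with
    | C a => rw [C_apply, rieszHom_monomial, hy0, mul_one, ← C_apply, eval_C]
    | add p q hp hq => rw [map_add, map_add, hp, hq]
    | mul_X p i hp => rw [mul_comm, hR.map_X_mul hy, hp, map_mul, eval_X]
  refine ⟨x, fun j => ?_, fun α => ?_⟩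
  · have := hpos.2 j 1
    rwa [one_pow, mul_one, key] at this
  · rw [← eval_monomial_one, ← key, rieszHom_monomial, one_mul]

/-- Normalized solution of the moment problem: by the Krein-Milman theorem the state space is the
closed convex hull of the moment sequences of the points of `X`, and the moment sequences of
probability measures on `X` form a compact convex set. -/
lemma PolySystem.IsRadius.exists_probabilityMeasure {S : PolySystem n m} {R : ℝ}
    (hR : S.IsRadius R) {y : (Fin n →₀ ℕ) → ℝ} (hy : y ∈ S.stateSpace) :
    ∃ μ : Measure (Fin n → ℝ), S.IsMeasureOn μ ∧ momentSeq μ = y := by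
  have : CompactSpace S.X := isCompact_iff_compactSpace.1 hR.isCompact
  let mon : (Fin n →₀ ℕ) → C(S.X, ℝ) := fun α =>
    ⟨fun x => ∏ i, x.1 i ^ α i, (continuous_monomial α).comp continuous_subtype_val⟩
  let Φ : ProbabilityMeasure S.X → (Fin n →₀ ℕ) → ℝ := fun P α => ∫ x, mon α x ∂(P : Measure S.X)
  have hint : ∀ (ν : Measure S.X) [IsFiniteMeasure ν] (α), Integrable (fun x => mon α x) ν :=
    fun ν _ α => (BoundedContinuousFunction.mkOfCompact (mon α)).integrable ν
  have hΦ : Continuous Φ := continuous_pi fun α =>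
    ProbabilityMeasure.continuous_integral_boundedContinuousFunction
      (BoundedContinuousFunction.mkOfCompact (mon α))
  have hcpt : IsCompact (Set.range Φ) := isCompact_range hΦ
  have hconv : Convex ℝ (Set.range Φ) := by
    rintro _ ⟨P, rfl⟩ _ ⟨Q, rfl⟩ a b ha hb hab
    let ν : Measure S.X :=
      ENNReal.ofReal a • (P : Measure S.X) + ENNReal.ofReal b • (Q : Measure S.X)
    have hν : IsProbabilityMeasure ν := ⟨by
      simp [ν, ← ENNReal.ofReal_add ha hb, hab]⟩
    refine ⟨⟨ν, hν⟩, ?_⟩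
    ext α
    change ∫ x, mon α x ∂ν =
      a * ∫ x, mon α x ∂(P : Measure S.X) + b * ∫ x, mon α x ∂(Q : Measure S.X)
    have i1 := (hint P α).smul_measure (c := ENNReal.ofReal a) ENNReal.ofReal_ne_top
    have i2 := (hint Q α).smul_measure (c := ENNReal.ofReal b) ENNReal.ofReal_ne_top
    rw [integral_add_measure i1 i2, integral_smul_measure, integral_smul_measure,
      ENNReal.toReal_ofReal ha, ENNReal.toReal_ofReal hb, smul_eq_mul, smul_eq_mul]
  have hext : Set.extremePoints ℝ S.stateSpace ⊆ Set.range Φ := by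
    intro z hz
    obtain ⟨x, hx, hxz⟩ := hR.exists_eval_of_mem_extremePoints hz
    refine ⟨⟨Measure.dirac ⟨x, hx⟩, inferInstance⟩, ?_⟩
    ext α
    change ∫ x, mon α x ∂(Measure.dirac (⟨x, hx⟩ : S.X)) = z α
    rw [integral_dirac, hxz]
    rfl
  have hsub : S.stateSpace ⊆ Set.range Φ := by
    rw [← closure_convexHull_extremePoints hR.isCompact_stateSpace S.convex_stateSpace]
    exact closure_minimal (convexHull_min hext hconv) hcpt.isClosed
  obtain ⟨P, rfl⟩ := hsub hy
  refine ⟨(P : Measure S.X).map Subtype.val, ⟨?_, ?_⟩, ?_⟩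
  · exact Measure.isFiniteMeasure_map _ _
  · rw [Measure.map_apply measurable_subtype_coe S.isClosed_X.measurableSet.compl]
    simp
  · ext α
    rw [momentSeq, integral_map measurable_subtype_coe.aemeasurable
      (continuous_monomial α).aestronglyMeasurable]
    rfl

/-- The moment problem on `X`: a sequence satisfying the constraints of all orders is the moment
sequence of a measure on `X`. -/
theorem PolySystem.IsRadius.exists_measure {S : PolySystem n m} {R : ℝ} (hR : S.IsRadius R)
    {y : (Fin n →₀ ℕ) → ℝ} (hy : ∀ r, S.LocPSD r y) :
    ∃ μ : Measure (Fin n → ℝ), S.IsMeasureOn μ ∧ momentSeq μ = y := by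
  have hpos := (S.isPos_rieszHom_iff y).2 hy
  have h0 : 0 ≤ y 0 := by
    have := hpos.1 1
    rwa [one_pow, rieszHom_one] at this
  rcases h0.eq_or_lt with h00 | h00
  · have hz := hpos.eq_zero hR (by rw [rieszHom_one, h00])
    refine ⟨0, ⟨inferInstance, by simp⟩, ?_⟩
    ext α
    have : rieszHom y (monomial α 1) = 0 := by rw [hz, LinearMap.zero_apply]
    rw [rieszHom_monomial, one_mul] at this
    simp [momentSeq, this]
  · obtain ⟨μ, hμ, hμy⟩ := hR.exists_probabilityMeasure (y := (y 0)⁻¹ • y) (by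
      rw [S.mem_stateSpace_iff]
      have e : rieszHom ((y 0)⁻¹ • y) = (y 0)⁻¹ • rieszHom y := by simp [rieszHom, map_smul]
      rw [e]
      exact ⟨by simp [h00.ne'], hpos.smul (inv_nonneg.2 h0)⟩)
    have := hμ.1
    refine ⟨ENNReal.ofReal (y 0) • μ, ⟨?_, ?_⟩, ?_⟩
    · exact Measure.smul_finite _ ENNReal.ofReal_ne_top
    · simp [hμ.2]
    · ext α
      have h1 := congrFun hμy α
      rw [momentSeq, integral_smul_measure, ENNReal.toReal_ofReal h0]
      rw [momentSeq] at h1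
      rw [h1]
      simp [h00.ne']

/-! ### Invariance is determined by polynomial test functions -/

lemma contDiff_eval (p : MvPolynomial (Fin n) ℝ) : ContDiff ℝ 1 fun x : Fin n → ℝ => eval x p := by
  have : (fun x : Fin n → ℝ => eval x p) =
      fun x => ∑ α ∈ p.support, p.coeff α * ∏ i, x i ^ α i := funext fun x => eval_eq' x p
  rw [this]
  fun_prop

lemma hasFDerivAt_eval (p : MvPolynomial (Fin n) ℝ) (x : Fin n → ℝ) :
    HasFDerivAt (fun x : Fin n → ℝ => eval x p)
      (∑ i, eval x (pderiv i p) • ContinuousLinearMap.proj (R := ℝ) (φ := fun _ : Fin n => ℝ) i)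
      x := by
  induction p using MvPolynomial.induction_on with
  | C a => simpa using hasFDerivAt_const a x
  | add p q hp hq =>
    simp only [map_add, add_smul, Finset.sum_add_distrib]
    exact hp.add hq
  | mul_X p j hp =>
    have h1 := hp.mul (hasFDerivAt_apply (𝕜 := ℝ) j x)
    simp only [map_mul, eval_X]
    refine h1.congr_fderiv ?_
    ext v
    simp [Derivation.leibniz, pderiv_X, Finset.sum_add_distrib, add_mul, mul_assoc, Finset.mul_sum,
      Pi.single_apply, mul_ite]
    rw [Finset.sum_eq_single j (fun i _ hij => by simp [hij.symm]) (by simp)]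
    simp only [if_true]

lemma fderiv_eval_apply (p : MvPolynomial (Fin n) ℝ) (x v : Fin n → ℝ) :
    fderiv ℝ (fun x : Fin n → ℝ => eval x p) x v = ∑ i, eval x (pderiv i p) * v i := by
  rw [(hasFDerivAt_eval p x).fderiv]
  simp

/-- Finite measures carried by a compact set are determined by their integrals of polynomials. -/
lemma ext_of_integral_eval_eq {K : Set (Fin n → ℝ)} (hK : IsCompact K) {μ ν : Measure (Fin n → ℝ)}
    [IsFiniteMeasure μ] [IsFiniteMeasure ν] (hμ : μ Kᶜ = 0) (hν : ν Kᶜ = 0)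
    (h : ∀ p : MvPolynomial (Fin n) ℝ, ∫ x, eval x p ∂μ = ∫ x, eval x p ∂ν) : μ = ν := by
  have intOn : ∀ (ρ : Measure (Fin n → ℝ)) [IsFiniteMeasure ρ], ρ Kᶜ = 0 →
      ∀ f : (Fin n → ℝ) → ℝ, Continuous f → Integrable f ρ := by
    intro ρ _ hρ f hf
    have h1 : IntegrableOn f K ρ := hf.continuousOn.integrableOn_compact hK
    rwa [IntegrableOn, Measure.restrict_eq_self_of_ae_mem hρ] at h1
  refine ext_of_forall_integral_eq_of_IsFiniteMeasure fun f => ?_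
  let ev : MvPolynomial (Fin n) ℝ →ₐ[ℝ] C(Fin n → ℝ, ℝ) :=
    aeval fun i => ⟨fun x => x i, continuous_apply i⟩
  have hev : ∀ p x, ev p x = eval x p := by
    intro p x
    induction p using MvPolynomial.induction_on with
    | C a => simp [ev]
    | add p q hp hq => rw [map_add, map_add, ContinuousMap.add_apply, hp, hq]
    | mul_X p i hp =>
      rw [map_mul, map_mul, ContinuousMap.mul_apply, hp, eval_X]
      simp [ev]
  have hsep : ev.range.SeparatesPoints := by
    intro x y hxy
    obtain ⟨i, hi⟩ := Function.ne_iff.1 hxy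
    refine ⟨ev (X i), ⟨ev (X i), ⟨X i, rfl⟩, rfl⟩, ?_⟩
    simpa [hev] using hi
  have close : ∀ (ρ : Measure (Fin n → ℝ)) [IsFiniteMeasure ρ], ρ Kᶜ = 0 → ∀ (ε : ℝ)
      (p : MvPolynomial (Fin n) ℝ), (∀ x ∈ K, ‖eval x p - f x‖ < ε) →
      |∫ x, eval x p ∂ρ - ∫ x, f x ∂ρ| ≤ ε * ρ.real Set.univ := by
    intro ρ _ hρ ε p hp
    rw [← integral_sub (intOn ρ hρ _ (continuous_eval p)) (f.integrable ρ)]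
    refine norm_integral_le_of_norm_le_const (μ := ρ) (C := ε) (f := fun x => eval x p - f x) ?_
    have : ∀ᵐ x ∂ρ, x ∈ K := hρ
    filter_upwards [this] with x hx using (hp x hx).le
  refine eq_of_forall_dist_le fun ε hε => ?_
  set M := μ.real Set.univ + ν.real Set.univ + 1 with hM
  have hM0 : 0 < M := by positivity
  obtain ⟨_, ⟨p, rfl⟩, hp⟩ :=
    ContinuousMap.exists_mem_subalgebra_near_continuous_of_isCompact_of_separatesPoints hsep
      f.toContinuousMap hK (div_pos hε hM0)
  have hp' : ∀ x ∈ K, ‖eval x p - f x‖ < ε / M := fun x hx => by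
    rw [← hev]
    exact hp x hx
  have h1 := close μ hμ _ p hp'
  have h2 := close ν hν _ p hp'
  rw [h p] at h1
  have h3 : ε / M * μ.real Set.univ + ε / M * ν.real Set.univ ≤ ε := by
    rw [← mul_add]
    calc ε / M * (μ.real Set.univ + ν.real Set.univ) ≤ ε / M * M := by
          gcongr
          rw [hM]
          linarith
      _ = ε := div_mul_cancel₀ _ hM0.ne'
  rw [Real.dist_eq]
  rw [abs_le] at h1 h2 ⊢
  constructor <;> linarith

lemma setIntegral_swap_of_continuous {E : Type*} [NormedAddCommGroup E] [MeasurableSpace E]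
    [BorelSpace E] [SecondCountableTopology E] {μ ν : Measure E} [SFinite μ] [SFinite ν]
    [IsFiniteMeasureOnCompacts μ] [IsFiniteMeasureOnCompacts ν]
    {s t : Set E} (hs : IsCompact s) (ht : IsCompact t) {f : E → E → ℝ}
    (hf : Continuous (Function.uncurry f)) :
    ∫ x in s, ∫ y in t, f x y ∂ν ∂μ = ∫ y in t, ∫ x in s, f x y ∂μ ∂ν := by
  refine integral_integral_swap ?_
  rw [Measure.prod_restrict]
  have : IntegrableOn (Function.uncurry f) (s ×ˢ t) (μ.prod ν) := by
    obtain ⟨c, hc⟩ := (hs.prod ht).exists_bound_of_continuousOn hf.continuousOn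
    refine Measure.integrableOn_of_bounded (M := c) ?_ hf.aestronglyMeasurable ?_
    · rw [Measure.prod_prod]
      exact ENNReal.mul_ne_top hs.measure_lt_top.ne ht.measure_lt_top.ne
    · rw [ae_restrict_iff' (hs.prod ht).measurableSet]
      exact Eventually.of_forall hc
  exact this

/-- A measure with compact support whose divergence along `F` vanishes on polynomials also
annihilates the compactly supported `C¹` functions: the translates of `φ` are averaged against the
polynomial peak functions `(c - |a|²)^k`, and integration by parts moves the derivative to the
polynomial. -/
lemma integral_fderiv_eq_zero_of_hasCompactSupport {K : Set (Fin n → ℝ)} (hK : IsCompact K)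
    {μ : Measure (Fin n → ℝ)} [IsFiniteMeasure μ] (hμ : μ.restrict K = μ)
    {F : (Fin n → ℝ) → Fin n → ℝ} (hF : Continuous F)
    (hpoly : ∀ p : MvPolynomial (Fin n) ℝ,
      ∫ x, fderiv ℝ (fun z : Fin n → ℝ => eval z p) x (F x) ∂μ = 0)
    {φ : (Fin n → ℝ) → ℝ} (hφ : ContDiff ℝ 1 φ) (hsupp : HasCompactSupport φ) :
    ∫ x, fderiv ℝ φ x (F x) ∂μ = 0 := by
  obtain ⟨ρ₁, hρ₁⟩ := hK.isBounded.exists_norm_le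
  obtain ⟨ρ₂, hρ₂⟩ := hsupp.isCompact.isBounded.exists_norm_le
  set ρ : ℝ := |ρ₁| + |ρ₂| + 1 with hρ
  have hρ0 : 0 < ρ := by positivity
  set s : Set (Fin n → ℝ) := Metric.closedBall 0 ρ with hs
  have hsc : IsCompact s := isCompact_closedBall _ _
  have htc : IsCompact (tsupport φ) := hsupp
  -- the norm is the sup norm, so `∑ a i ^ 2 ≤ n ρ ^ 2` on `s` and the peak function is nonnegative
  set c : (Fin n → ℝ) → ℝ := fun a => (n * ρ ^ 2 + 1) - ∑ i, a i ^ 2 with hc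
  have hcd : ContDiff ℝ 1 c := by rw [hc]; fun_prop
  have hout : ∀ x ∈ K, ∀ a ∉ s, x - a ∉ tsupport φ := by
    intro x hx a ha hmem
    have h1 := hρ₁ x hx
    have h2 := hρ₂ _ hmem
    rw [hs, mem_closedBall_zero_iff, not_le] at ha
    have h3 : ‖a‖ ≤ ‖x‖ + ‖x - a‖ := by
      have := norm_sub_le x (x - a)
      rwa [sub_sub_cancel] at this
    linarith [le_abs_self ρ₁, le_abs_self ρ₂]
  have hfd : Continuous fun q : (Fin n → ℝ) × (Fin n → ℝ) => fderiv ℝ φ q.1 q.2 :=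
    hφ.continuous_fderiv_apply one_ne_zero
  have hG : Continuous (Function.uncurry fun a x : Fin n → ℝ => fderiv ℝ φ (x - a) (F x)) :=
    hfd.comp ((continuous_snd.sub continuous_fst).prodMk (hF.comp continuous_snd))
  set H : (Fin n → ℝ) → ℝ := fun a => ∫ x in K, fderiv ℝ φ (x - a) (F x) ∂μ with hH
  have hHc : Continuous H := continuous_parametric_integral_of_continuous hG hK
  have hcs : ∀ x ∈ s, 0 ≤ c x := by
    intro x hx
    rw [hs, mem_closedBall_zero_iff] at hx
    have : ∑ i, x i ^ 2 ≤ ∑ _i : Fin n, ρ ^ 2 := by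
      refine Finset.sum_le_sum fun i _ => ?_
      rw [← sq_abs]
      have h1 : |x i| ≤ ‖x‖ := norm_le_pi_norm x i
      have h2 := h1.trans hx
      gcongr
    rw [Finset.sum_const, Finset.card_univ, Fintype.card_fin, nsmul_eq_mul] at this
    simp only [hc]
    linarith
  have hpeak := tendsto_setIntegral_pow_smul_of_unique_maximum_of_isCompact_of_continuousOn
    (μ := (volume : Measure (Fin n → ℝ))) (x₀ := 0) hsc hcd.continuous.continuousOn
    (fun y _ hy0 => by
      obtain ⟨i, hi⟩ := Function.ne_iff.1 hy0
      have h1 : 0 < ∑ i, y i ^ 2 :=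
        Finset.sum_pos' (fun i _ => sq_nonneg _)
          ⟨i, Finset.mem_univ i, by
            have hi' : y i ≠ 0 := hi
            positivity⟩
      simp only [hc, Pi.zero_apply]
      simpa using h1)
    hcs (by simp only [hc]; simp; positivity)
    (by
      refine subset_closure ?_
      rw [hs, interior_closedBall _ hρ0.ne']
      exact Metric.mem_ball_self hρ0)
    hHc.continuousOn
  have hzero : ∀ k : ℕ, ∫ a in s, c a ^ k • H a = 0 := by
    intro k
    have hck : ContDiff ℝ 1 fun a => c a ^ k := hcd.pow k
    have hdk : Continuous fun q : (Fin n → ℝ) × (Fin n → ℝ) =>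
        fderiv ℝ (fun a => c a ^ k) q.1 q.2 :=
      hck.continuous_fderiv_apply one_ne_zero
    have e1 : ∫ a in s, c a ^ k • H a =
        ∫ x in K, ∫ a in s, c a ^ k * fderiv ℝ φ (x - a) (F x) ∂volume ∂μ := by
      rw [← setIntegral_swap_of_continuous hsc hK
        (f := fun a x => c a ^ k * fderiv ℝ φ (x - a) (F x))
        (((hcd.continuous.comp continuous_fst).pow k).mul hG)]
      refine setIntegral_congr_fun hsc.measurableSet fun a _ => ?_
      simp only [hH, smul_eq_mul]
      rw [integral_const_mul]
    -- the integrand vanishes outside of `s`, which permits `b = x - a` and integration by parts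
    have e2 : ∀ x ∈ K, ∫ a in s, c a ^ k * fderiv ℝ φ (x - a) (F x) =
        ∫ b in tsupport φ, fderiv ℝ (fun a => c a ^ k) (x - b) (F x) * φ b := by
      intro x hx
      rw [setIntegral_eq_integral_of_forall_compl_eq_zero fun a ha => ?_]
      · rw [← integral_sub_left_eq_self _ volume x]
        simp only [sub_sub_cancel]
        have hcx : ContDiff ℝ 1 fun b => c (x - b) ^ k := hck.comp (contDiff_const.sub contDiff_id)
        have hder : ∀ b, fderiv ℝ (fun b => c (x - b) ^ k) b (F x) =
            -fderiv ℝ (fun a => c a ^ k) (x - b) (F x) := by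
          intro b
          have h1 : HasFDerivAt (fun b => c (x - b) ^ k)
              ((fderiv ℝ (fun a => c a ^ k) (x - b)).comp
                (-ContinuousLinearMap.id ℝ (Fin n → ℝ))) b :=
            ((hck.differentiable one_ne_zero (x - b)).hasFDerivAt).comp b
              ((hasFDerivAt_id b).const_sub x)
          rw [h1.fderiv]
          simp
        have cont1 : Continuous fun b => fderiv ℝ (fun b => c (x - b) ^ k) b (F x) :=
          (hcx.continuous_fderiv_apply one_ne_zero).comp (continuous_id.prodMk continuous_const)
        have cont2 : Continuous fun b => fderiv ℝ φ b (F x) :=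
          hfd.comp (continuous_id.prodMk continuous_const)
        rw [integral_mul_fderiv_eq_neg_fderiv_mul_of_integrable]
        · rw [← integral_neg, setIntegral_eq_integral_of_forall_compl_eq_zero fun b hb => ?_]
          · refine integral_congr_ae (Eventually.of_forall fun b => ?_)
            simp only [hder, neg_mul, neg_neg]
          · rw [image_eq_zero_of_notMem_tsupport hb, mul_zero]
        · exact (cont1.mul hφ.continuous).integrable_of_hasCompactSupport hsupp.mul_left
        · exact (hcx.continuous.mul cont2).integrable_of_hasCompactSupport
            (hsupp.fderiv_apply (𝕜 := ℝ) (F x)).mul_left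
        · exact (hcx.continuous.mul hφ.continuous).integrable_of_hasCompactSupport hsupp.mul_left
        · exact fun b _ => hcx.differentiable one_ne_zero b
        · exact fun b _ => hφ.differentiable one_ne_zero b
      · have h1 : x - a ∉ Function.support (fderiv ℝ φ) := fun h =>
          hout x hx a ha (support_fderiv_subset ℝ h)
        rw [Function.notMem_support.1 h1]
        simp
    -- `x ↦ c (x - b) ^ k` is a polynomial
    have e3 : ∀ b, ∫ x in K, fderiv ℝ (fun a => c a ^ k) (x - b) (F x) * φ b ∂μ = 0 := by
      intro b
      rw [integral_mul_const, hμ]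
      have h1 := hpoly ((C (n * ρ ^ 2 + 1) - ∑ i, (X i - C (b i)) ^ 2) ^ k)
      have h2 : (fun z : Fin n → ℝ =>
          eval z ((C (n * ρ ^ 2 + 1) - ∑ i, (X i - C (b i)) ^ 2 : MvPolynomial (Fin n) ℝ) ^ k)) =
          fun z => c (z - b) ^ k := by
        ext z
        simp only [map_pow, map_sub, map_sum, eval_C, eval_X, hc, Pi.sub_apply]
      rw [h2] at h1
      have h3 : ∀ x, fderiv ℝ (fun z => c (z - b) ^ k) x = fderiv ℝ (fun a => c a ^ k) (x - b) :=
        fun x => fderiv_comp_sub (f := fun a => c a ^ k) b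
      simp only [h3] at h1
      rw [h1, zero_mul]
    rw [e1, setIntegral_congr_fun hK.measurableSet e2,
      ← setIntegral_swap_of_continuous (μ := volume) (ν := μ) htc hK]
    · simp only [e3, integral_zero]
    · exact (hdk.comp ((continuous_snd.sub continuous_fst).prodMk (hF.comp continuous_snd))).mul
        (hφ.continuous.comp continuous_fst)
  simp only [hzero, smul_zero] at hpeak
  have h0 : H 0 = 0 := tendsto_nhds_unique hpeak tendsto_const_nhds
  simp only [hH, sub_zero, hμ] at h0
  exact h0

/-- Invariance in continuous time may be tested on polynomials. -/
lemma integral_fderiv_eq_zero {K : Set (Fin n → ℝ)} (hK : IsCompact K)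
    {μ : Measure (Fin n → ℝ)} [IsFiniteMeasure μ] (hμ : μ.restrict K = μ)
    {F : (Fin n → ℝ) → Fin n → ℝ} (hF : Continuous F)
    (hpoly : ∀ p : MvPolynomial (Fin n) ℝ,
      ∫ x, fderiv ℝ (fun z : Fin n → ℝ => eval z p) x (F x) ∂μ = 0)
    {φ : (Fin n → ℝ) → ℝ} (hφ : ContDiff ℝ 1 φ) : ∫ x, fderiv ℝ φ x (F x) ∂μ = 0 := by
  obtain ⟨ρ, hρ⟩ := hK.isBounded.exists_norm_le
  -- a cutoff function which is `1` near `K`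
  let χ : ContDiffBump (0 : Fin n → ℝ) := ⟨|ρ| + 1, |ρ| + 2, by positivity, by linarith⟩
  have h := integral_fderiv_eq_zero_of_hasCompactSupport hK hμ hF hpoly
    (φ := fun x => χ x * φ x) (χ.contDiff.mul hφ) χ.hasCompactSupport.mul_right
  rw [← h, ← hμ]
  refine setIntegral_congr_fun hK.measurableSet fun x hx => ?_
  have hxb : x ∈ Metric.ball (0 : Fin n → ℝ) χ.rIn := by
    rw [mem_ball_zero_iff]
    have := hρ x hx
    change ‖x‖ < |ρ| + 1
    linarith [le_abs_self ρ]
  have hev : φ =ᶠ[𝓝 x] fun x => χ x * φ x := by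
    filter_upwards [Metric.isOpen_ball.mem_nhds hxb] with z hz
    rw [χ.one_of_mem_closedBall (Metric.ball_subset_closedBall hz), one_mul]
  change fderiv ℝ φ x (F x) = fderiv ℝ (fun x => χ x * φ x) x (F x)
  rw [hev.fderiv_eq]

lemma PolySystem.continuous_map (S : PolySystem n m) : Continuous S.map :=
  continuous_pi fun i => continuous_eval (S.f i)

/-- The operator on polynomials through which the constraint `L(μ) = 0` is tested: `p ∘ f - p` in
discrete time, `∇p · f` in continuous time. -/
noncomputable def PolySystem.generator (S : PolySystem n m) :
    MvPolynomial (Fin n) ℝ →ₗ[ℝ] MvPolynomial (Fin n) ℝ :=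
  match S.time with
  | .discrete => (bind₁ S.f).toLinearMap - LinearMap.id
  | .continuous => ∑ i, LinearMap.mulRight ℝ (S.f i) ∘ₗ (pderiv i).toLinearMap

lemma PolySystem.invFunctional_eq (S : PolySystem n m) (y : (Fin n →₀ ℕ) → ℝ)
    (p : MvPolynomial (Fin n) ℝ) : S.invFunctional y p = riesz y (S.generator p) := by
  unfold invFunctional generator
  cases S.time with
  | discrete => simp [← rieszHom_apply]
  | continuous => simp [LinearMap.sum_apply]

lemma PolySystem.eval_map (S : PolySystem n m) (x : Fin n → ℝ) (p : MvPolynomial (Fin n) ℝ) :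
    MvPolynomial.eval (S.map x) p = MvPolynomial.eval x (bind₁ S.f p) := by
  simp only [← coe_aeval_eq_eval, RingHom.coe_coe, aeval_bind₁]
  rfl

/-- A measure on `X` is invariant iff it is invariant on monomials. -/
lemma PolySystem.IsMeasureOn.isInvariant_iff {S : PolySystem n m} (hX : IsCompact S.X)
    {μ : Measure (Fin n → ℝ)} (h : S.IsMeasureOn μ) :
    S.IsInvariant μ ↔ ∀ α, S.invFunctional (momentSeq μ) (monomial α 1) = 0 := by
  have hfin := h.1
  trans ∀ p, ∫ x, MvPolynomial.eval x (S.generator p) ∂μ = 0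
  · unfold IsInvariant generator
    cases S.time with
    | discrete =>
      have e : ∀ p, ∫ x, MvPolynomial.eval x (((bind₁ S.f).toLinearMap - LinearMap.id :
          MvPolynomial (Fin n) ℝ →ₗ[ℝ] MvPolynomial (Fin n) ℝ) p) ∂μ =
          ∫ x, MvPolynomial.eval x p ∂(μ.map S.map) - ∫ x, MvPolynomial.eval x p ∂μ := by
        intro p
        have hi := h.integrable hX (f := fun x => MvPolynomial.eval (S.map x) p)
          ((continuous_eval p).comp S.continuous_map)
        rw [integral_map S.continuous_map.aemeasurable (continuous_eval p).aestronglyMeasurable,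
          ← integral_sub hi (h.integrable hX (continuous_eval p))]
        simp only [LinearMap.sub_apply, AlgHom.toLinearMap_apply, LinearMap.id_apply, map_sub,
          S.eval_map]
      simp only [e, sub_eq_zero]
      refine ⟨fun hinv p => by rw [hinv], fun hp => ?_⟩
      have hm : IsFiniteMeasure (μ.map S.map) := Measure.isFiniteMeasure_map _ _
      refine ext_of_integral_eval_eq (hX.union (hX.image S.continuous_map)) ?_ ?_ hp
      · rw [Measure.map_apply S.continuous_map.measurable
          (hX.union (hX.image S.continuous_map)).measurableSet.compl]
        refine measure_mono_null (t := S.Xᶜ) (fun x hx hxX => hx ?_) h.2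
        exact Or.inr ⟨x, hxX, rfl⟩
      · exact measure_mono_null (Set.compl_subset_compl.2 Set.subset_union_left) h.2
    | continuous =>
      have e : ∀ p x, MvPolynomial.eval x ((∑ i, LinearMap.mulRight ℝ (S.f i) ∘ₗ
          (pderiv i).toLinearMap : MvPolynomial (Fin n) ℝ →ₗ[ℝ] MvPolynomial (Fin n) ℝ) p) =
          fderiv ℝ (fun z : Fin n → ℝ => MvPolynomial.eval z p) x (S.map x) := by
        intro p x
        rw [fderiv_eval_apply]
        simp [LinearMap.sum_apply, PolySystem.map]
      simp only [e]
      exact ⟨fun hinv p => hinv _ (contDiff_eval p), fun hp φ hφ =>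
        integral_fderiv_eq_zero hX h.restrict_eq S.continuous_map hp hφ⟩
  · simp only [← h.riesz_momentSeq hX, S.invFunctional_eq]
    refine ⟨fun hp α => hp _, fun hα p => ?_⟩
    have : rieszHom (momentSeq μ) ∘ₗ S.generator = 0 :=
      (basisMonomials (Fin n) ℝ).ext fun α => by
        rw [coe_basisMonomials, LinearMap.comp_apply, rieszHom_apply, hα, LinearMap.zero_apply]
    rw [← rieszHom_apply, ← LinearMap.comp_apply, this, LinearMap.zero_apply]

/-! ### The linear program -/

namespace PolySystem

variable {S : PolySystem n m}

lemma isFiniteMeasure_lebesgue (hX : IsCompact S.X) : IsFiniteMeasure S.lebesgue :=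
  isFiniteMeasure_restrict.2 hX.measure_lt_top.ne

lemma isMeasureOn_lebesgue (hX : IsCompact S.X) : S.IsMeasureOn S.lebesgue :=
  ⟨isFiniteMeasure_lebesgue hX, by
    rw [lebesgue, Measure.restrict_apply hX.measurableSet.compl]
    simp⟩

lemma IsMeasureOn.mono {μ ν : Measure (Fin n → ℝ)} (hμ : S.IsMeasureOn μ) (h : ν ≤ μ) :
    S.IsMeasureOn ν := by
  have := hμ.1
  exact ⟨isFiniteMeasure_of_le μ h, le_antisymm ((h _).trans_eq hμ.2) zero_le⟩

lemma cappedPart_le_lebesgue (S : PolySystem n m) (μ : Measure (Fin n → ℝ)) :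
    S.cappedPart μ ≤ S.lebesgue := by
  refine (withDensity_mono (g := 1) (Eventually.of_forall fun _ => min_le_left _ _)).trans_eq ?_
  exact withDensity_one

lemma cappedPart_le (S : PolySystem n m) (μ : Measure (Fin n → ℝ)) : S.cappedPart μ ≤ μ :=
  (withDensity_mono (Eventually.of_forall fun _ => min_le_right _ _)).trans
    (Measure.withDensity_rnDeriv_le μ S.lebesgue)

/-- `min(1, h) λ_X` is the largest measure below both `μ` and `λ_X`. -/
lemma le_cappedPart (hX : IsCompact S.X) {μ ν : Measure (Fin n → ℝ)} (hμ : S.IsMeasureOn μ)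
    (h1 : ν ≤ μ) (h2 : ν ≤ S.lebesgue) : ν ≤ S.cappedPart μ := by
  have := hμ.1
  have := isFiniteMeasure_lebesgue hX
  have := Measure.haveLebesgueDecomposition_of_sigmaFinite μ S.lebesgue
  obtain ⟨N, hN, hNs, hNl⟩ := Measure.mutuallySingular_singularPart μ S.lebesgue
  set h := μ.rnDeriv S.lebesgue with hh
  have hm : Measurable h := Measure.measurable_rnDeriv _ _
  set B : Set (Fin n → ℝ) := {x | h x ≤ 1} with hB
  have hBm : MeasurableSet B := measurableSet_le hm measurable_const
  refine Measure.le_iff.2 fun A hA => ?_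
  -- up to a `λ_X`-null set, `ν` is compared with `h λ_X` where `h ≤ 1` and with `λ_X` elsewhere
  have e0 : ν A ≤ ν (A ∩ N) := by
    have : ν (A \ N) = 0 :=
      le_antisymm (((measure_mono (Set.sdiff_subset_compl A N)).trans (h2 _)).trans_eq hNl) zero_le
    calc ν A ≤ ν (A ∩ N) + ν (A \ N) := measure_le_inter_add_sdiff ν A N
      _ = ν (A ∩ N) := by rw [this, add_zero]
  have hAN : MeasurableSet (A ∩ N) := hA.inter hN
  have e1 : ν (A ∩ N ∩ B) ≤ S.cappedPart μ (A ∩ N ∩ B) := by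
    refine (h1 _).trans ?_
    conv_lhs => rw [Measure.haveLebesgueDecomposition_add μ S.lebesgue]
    rw [Measure.add_apply,
      measure_mono_null (Set.inter_subset_left.trans Set.inter_subset_right) hNs, zero_add,
      cappedPart, withDensity_apply _ (hAN.inter hBm), withDensity_apply _ (hAN.inter hBm)]
    refine (setLIntegral_congr_fun (hAN.inter hBm) fun x hx => ?_).le
    exact (min_eq_right hx.2).symm
  have e2 : ν ((A ∩ N) \ B) ≤ S.cappedPart μ ((A ∩ N) \ B) := by
    refine (h2 _).trans ?_
    rw [cappedPart, withDensity_apply _ (hAN.diff hBm), ← setLIntegral_one]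
    refine (setLIntegral_congr_fun (hAN.diff hBm) fun x hx => ?_).le
    exact (min_eq_left (not_le.1 hx.2).le).symm
  calc ν A ≤ ν (A ∩ N) := e0
    _ = ν (A ∩ N ∩ B) + ν ((A ∩ N) \ B) := (measure_inter_add_sdiff _ hBm).symm
    _ ≤ S.cappedPart μ (A ∩ N ∩ B) + S.cappedPart μ ((A ∩ N) \ B) := add_le_add e1 e2
    _ = S.cappedPart μ (A ∩ N) := measure_inter_add_sdiff _ hBm
    _ ≤ S.cappedPart μ A := measure_mono Set.inter_subset_left

lemma lpFeasible_cappedPart (hX : IsCompact S.X) {μ : Measure (Fin n → ℝ)}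
    (hμ : S.IsInvariantProbability μ) :
    S.LPFeasible ⟨μ, S.cappedPart μ, S.lebesgue - S.cappedPart μ, μ - S.cappedPart μ⟩ := by
  have hl := isMeasureOn_lebesgue hX
  have hc := hμ.1.mono (S.cappedPart_le μ)
  have := hc.1
  refine ⟨hμ.1, hc, hl.mono Measure.sub_le, hμ.1.mono Measure.sub_le, hμ.2.1, hμ.2.2, ?_, ?_⟩
  · rw [add_comm]
    exact Measure.sub_add_cancel_of_le (S.cappedPart_le μ)
  · rw [add_comm]
    exact Measure.sub_add_cancel_of_le (S.cappedPart_le_lebesgue μ)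

lemma LPFeasible.nu_le_cappedPart (hX : IsCompact S.X) {q : MeasureQuad n} (hq : S.LPFeasible q) :
    q.nu ≤ S.cappedPart q.mu := by
  refine le_cappedPart hX hq.mu_mem ?_ ?_
  · rw [← hq.nu_add_psi]
    exact Measure.le_add_right le_rfl
  · rw [← hq.nu_add_nuHat]
    exact Measure.le_add_right le_rfl

lemma LPFeasible.mu_eq {μ : Measure (Fin n → ℝ)}
    (huniq : ∀ μ' : Measure (Fin n → ℝ), S.IsInvariantProbability μ' → μ' = μ)
    {q : MeasureQuad n} (hq : S.LPFeasible q) : q.mu = μ :=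
  huniq _ ⟨hq.mu_mem, hq.mass, hq.invariant⟩

lemma LPFeasible.real_nu_le (hX : IsCompact S.X) {μ : Measure (Fin n → ℝ)}
    (huniq : ∀ μ' : Measure (Fin n → ℝ), S.IsInvariantProbability μ' → μ' = μ)
    {q : MeasureQuad n} (hq : S.LPFeasible q) :
    q.nu.real Set.univ ≤ (S.cappedPart μ).real Set.univ := by
  have h1 := hq.nu_le_cappedPart hX
  have := (hq.mu_mem.mono (S.cappedPart_le q.mu)).1
  rw [← hq.mu_eq huniq]
  exact ENNReal.toReal_mono (measure_ne_top _ _) (h1 _)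

/-- A feasible point whose objective value is at least the mass of `min(1, h) λ_X` is the claimed
optimal solution. -/
lemma LPFeasible.eq_of_le (hX : IsCompact S.X) {μ : Measure (Fin n → ℝ)}
    (huniq : ∀ μ' : Measure (Fin n → ℝ), S.IsInvariantProbability μ' → μ' = μ)
    {q : MeasureQuad n} (hq : S.LPFeasible q)
    (hle : (S.cappedPart μ).real Set.univ ≤ q.nu.real Set.univ) :
    q = ⟨μ, S.cappedPart μ, S.lebesgue - S.cappedPart μ, μ - S.cappedPart μ⟩ := by
  have e1 := hq.mu_eq huniq
  have h1 := hq.nu_le_cappedPart hX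
  have := (hq.mu_mem.mono (S.cappedPart_le q.mu)).1
  have := hq.nu_mem.1
  have e2 : q.nu = S.cappedPart μ := by
    rw [← e1] at hle ⊢
    refine Measure.eq_of_le_of_measure_univ_eq h1 (le_antisymm (h1 _) ?_)
    exact (ENNReal.toReal_le_toReal (measure_ne_top _ _) (measure_ne_top _ _)).1 hle
  have e3 : q.nuHat = S.lebesgue - S.cappedPart μ := by
    rw [← hq.nu_add_nuHat, ← e2, add_comm, Measure.add_sub_cancel]
  have e4 : q.psi = μ - S.cappedPart μ := by
    rw [← e1] at e2 ⊢
    rw [← e2, ← hq.nu_add_psi, add_comm, Measure.add_sub_cancel]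
  cases q
  simp only [MeasureQuad.mk.injEq] at *
  exact ⟨e1, e2, e3, e4⟩

theorem lpOptimal_iff (hX : IsCompact S.X) {μ : Measure (Fin n → ℝ)}
    (hμ : S.IsInvariantProbability μ)
    (huniq : ∀ μ' : Measure (Fin n → ℝ), S.IsInvariantProbability μ' → μ' = μ)
    (q : MeasureQuad n) :
    S.LPOptimal q ↔
      q = ⟨μ, S.cappedPart μ, S.lebesgue - S.cappedPart μ, μ - S.cappedPart μ⟩ := by
  constructor
  · intro hq
    exact hq.1.eq_of_le hX huniq (hq.2 _ (lpFeasible_cappedPart hX hμ))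
  · rintro rfl
    exact ⟨lpFeasible_cappedPart hX hμ, fun q' hq' => hq'.real_nu_le hX huniq⟩

lemma lpValue_eq (hX : IsCompact S.X) {μ : Measure (Fin n → ℝ)}
    (hμ : S.IsInvariantProbability μ)
    (huniq : ∀ μ' : Measure (Fin n → ℝ), S.IsInvariantProbability μ' → μ' = μ) :
    S.lpValue = ((S.cappedPart μ).real Set.univ : ℝ) := by
  refine le_antisymm (iSup₂_le fun q hq => ?_) ?_
  · exact EReal.coe_le_coe_iff.2 (hq.real_nu_le hX huniq)
  · exact le_iSup₂ (f := fun (q : MeasureQuad n) (_ : S.LPFeasible q) =>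
      ((q.nu.real Set.univ : ℝ) : EReal)) _ (lpFeasible_cappedPart hX hμ)

end PolySystem

/-! ### Feasible points of the semidefinite programs -/

/-- The sequence `y` with the entries of degree larger than `d` replaced by zero. -/
noncomputable def truncateSeq (d : ℕ) : ((Fin n →₀ ℕ) → ℝ) →ₗ[ℝ] ((Fin n →₀ ℕ) → ℝ) where
  toFun y α := if α.degree ≤ d then y α else 0
  map_add' y z := by
    ext α
    by_cases h : α.degree ≤ d <;> simp [h]
  map_smul' c y := by
    ext α
    by_cases h : α.degree ≤ d <;> simp [h]

lemma truncateSeq_of_le {d : ℕ} (y : (Fin n →₀ ℕ) → ℝ) {α : Fin n →₀ ℕ} (h : α.degree ≤ d) :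
    truncateSeq d y α = y α :=
  if_pos h

lemma truncateSeq_of_lt {d : ℕ} (y : (Fin n →₀ ℕ) → ℝ) {α : Fin n →₀ ℕ} (h : d < α.degree) :
    truncateSeq d y α = 0 :=
  if_neg (not_le.2 h)

namespace PolySystem

variable {S : PolySystem n m}

lemma two_mul_le_truncDegree (S : PolySystem n m) (r : ℕ) : 2 * r ≤ S.truncDegree r := by
  unfold truncDegree
  cases S.time with
  | discrete => exact Nat.le_mul_of_pos_right _ (by omega)
  | continuous => exact Nat.le_add_right _ _

lemma totalDegree_f_le (S : PolySystem n m) (i : Fin n) : (S.f i).totalDegree ≤ S.degF :=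
  Finset.le_sup (f := fun i => (S.f i).totalDegree) (Finset.mem_univ i)

/-- The degree `D_r` suffices for all moments which occur in the invariance constraints. If `f` is
constant, the truncated subtraction in `D_r` is harmless, since differentiation lowers the
degree. -/
lemma totalDegree_generator_le (S : PolySystem n m) {r : ℕ} {α : Fin n →₀ ℕ}
    (hα : α.degree ≤ 2 * r) :
    (S.generator (monomial α 1)).totalDegree ≤ S.truncDegree r := by
  unfold generator truncDegree
  cases S.time with
  | discrete =>
    simp only [LinearMap.sub_apply, AlgHom.toLinearMap_apply, LinearMap.id_apply]
    refine (totalDegree_sub _ _).trans (max_le ?_ ?_)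
    · rw [bind₁_monomial, C_1, one_mul]
      refine (totalDegree_finsetProd _ _).trans ?_
      calc ∑ i ∈ α.support, (S.f i ^ α i).totalDegree
          ≤ ∑ i ∈ α.support, α i * max 1 S.degF := by
            refine Finset.sum_le_sum fun i _ => (totalDegree_pow _ _).trans ?_
            exact Nat.mul_le_mul_left _ ((S.totalDegree_f_le i).trans (le_max_right _ _))
        _ = α.degree * max 1 S.degF := by rw [← Finset.sum_mul, Finsupp.degree_apply]
        _ ≤ 2 * r * max 1 S.degF := Nat.mul_le_mul_right _ hα
    · calc (monomial α (1 : ℝ)).totalDegree ≤ α.degree := totalDegree_monomial_le _ _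
        _ ≤ 2 * r := hα
        _ ≤ 2 * r * max 1 S.degF := Nat.le_mul_of_pos_right _ (by omega)
  | continuous =>
    simp only [LinearMap.sum_apply, LinearMap.comp_apply, LinearMap.mulRight_apply]
    refine totalDegree_finsetSum_le fun i _ => ?_
    change ((pderiv i) (monomial α 1) * S.f i).totalDegree ≤ _
    rw [pderiv_monomial]
    by_cases hi : α i = 0
    · simp [hi]
    · have h1 : (monomial (α - Finsupp.single i 1) (1 * (α i : ℝ))).totalDegree ≤
          (α - Finsupp.single i 1).degree := totalDegree_monomial_le _ _
      have h2 : (α - Finsupp.single i 1).degree + 1 = α.degree := by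
        conv_rhs => rw [← tsub_add_cancel_of_le (a := Finsupp.single i 1) (b := α)
          (Finsupp.single_le_iff.2 (by omega))]
        rw [map_add, Finsupp.degree_single]
      have h3 := S.totalDegree_f_le i
      have h4 := totalDegree_mul (monomial (α - Finsupp.single i 1) (1 * (α i : ℝ))) (S.f i)
      omega

lemma invFunctional_congr {S : PolySystem n m} {r : ℕ} {y y' : (Fin n →₀ ℕ) → ℝ}
    (h : ∀ α, α.degree ≤ S.truncDegree r → y α = y' α) {α : Fin n →₀ ℕ} (hα : α.degree ≤ 2 * r) :
    S.invFunctional y (monomial α 1) = S.invFunctional y' (monomial α 1) := by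
  rw [S.invFunctional_eq, S.invFunctional_eq]
  exact riesz_congr h (S.totalDegree_generator_le hα)

lemma IsMeasureOn.momentSeq_add (hX : IsCompact S.X) {μ ν : Measure (Fin n → ℝ)}
    (hμ : S.IsMeasureOn μ) (hν : S.IsMeasureOn ν) (α : Fin n →₀ ℕ) :
    momentSeq (μ + ν) α = momentSeq μ α + momentSeq ν α :=
  integral_add_measure (hμ.integrable hX (continuous_monomial α))
    (hν.integrable hX (continuous_monomial α))

/-- The semidefinite programs are relaxations of the linear program. -/
lemma LPFeasible.sdpFeasible (hX : IsCompact S.X) {q : MeasureQuad n} (hq : S.LPFeasible q) {r : ℕ}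
    (hr : S.rMin ≤ r) :
    S.SDPFeasible r ⟨truncateSeq (S.truncDegree r) (momentSeq q.mu),
      truncateSeq (2 * r) (momentSeq q.nu), truncateSeq (2 * r) (momentSeq q.nuHat),
      truncateSeq (2 * r) (momentSeq q.psi)⟩ := by
  have hD := S.two_mul_le_truncDegree r
  have psd : ∀ (d : ℕ) (ρ : Measure (Fin n → ℝ)), 2 * r ≤ d → S.IsMeasureOn ρ →
      S.LocPSD r (truncateSeq d (momentSeq ρ)) := fun d ρ hd hρ =>
    (hρ.locPSD hX r).congr hr fun α hα => (truncateSeq_of_le _ (hα.trans hd)).symm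
  refine ⟨fun α => truncateSeq_of_lt _, fun α => truncateSeq_of_lt _, fun α => truncateSeq_of_lt _,
    fun α => truncateSeq_of_lt _, ?_, fun α hα => ?_, fun α hα => ?_, fun α hα => ?_,
    psd _ _ hD hq.mu_mem, psd _ _ le_rfl hq.nu_mem, psd _ _ le_rfl hq.nuHat_mem,
    psd _ _ le_rfl hq.psi_mem⟩
  · change truncateSeq _ _ _ = _
    rw [truncateSeq_of_le _ (by simp), momentSeq_zero_eq, Measure.real, hq.mass, ENNReal.toReal_one]
  · rw [invFunctional_congr (y' := momentSeq q.mu) (fun β hβ => truncateSeq_of_le _ hβ) hα]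
    exact (hq.mu_mem.isInvariant_iff hX).1 hq.invariant α
  · simp only [truncateSeq_of_le _ hα, truncateSeq_of_le _ (hα.trans hD)]
    rw [← hq.nu_add_psi, hq.nu_mem.momentSeq_add hX hq.psi_mem]
  · simp only [truncateSeq_of_le _ hα]
    rw [← hq.nu_add_nuHat, hq.nu_mem.momentSeq_add hX hq.nuHat_mem]

lemma LocPSD.zero_nonneg {r : ℕ} {y : (Fin n →₀ ℕ) → ℝ} (hy : S.LocPSD r y) : 0 ≤ y 0 := by
  have := ((S.locPSD_iff r y).1 hy).1 1 (by simp)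
  rwa [one_pow, ← rieszHom_apply, rieszHom_one] at this

lemma LocPSD.abs_moment_le_of_le {R : ℝ} (hR : S.IsRadius R) {r : ℕ} {y : (Fin n →₀ ℕ) → ℝ}
    (hy : S.LocPSD r y) {c : ℝ} (hc : y 0 ≤ c) {α : Fin n →₀ ℕ} (hα : α.degree ≤ 2 * r) :
    |y α| ≤ R ^ α.degree * c := by
  have hRp := hR.pos
  exact (hy.abs_moment_le hR hα).trans (by gcongr)

/-- A bound for the moments of order `α` of the feasible points, in all four components. -/
noncomputable def momentBound (S : PolySystem n m) (R : ℝ) (α : Fin n →₀ ℕ) : ℝ :=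
  R ^ α.degree * max 1 (momentSeq S.lebesgue 0)

/-- The constraints of order `r` bound all moments up to degree `2r`. -/
lemma abs_le_momentBound {R : ℝ} (hR : S.IsRadius R) {r : ℕ} {u v w y : (Fin n →₀ ℕ) → ℝ}
    (h1 : u 0 = 1) (h2 : v 0 + y 0 = u 0) (h3 : v 0 + w 0 = momentSeq S.lebesgue 0)
    (hu : S.LocPSD r u) (hv : S.LocPSD r v) (hw : S.LocPSD r w) (hy : S.LocPSD r y)
    {α : Fin n →₀ ℕ} (hα : α.degree ≤ 2 * r) :
    |u α| ≤ S.momentBound R α ∧ |v α| ≤ S.momentBound R α ∧ |w α| ≤ S.momentBound R α ∧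
      |y α| ≤ S.momentBound R α := by
  have hv0 := hv.zero_nonneg
  have hy0 := hy.zero_nonneg
  have hm1 := le_max_left 1 (momentSeq S.lebesgue 0)
  have hm2 := le_max_right 1 (momentSeq S.lebesgue 0)
  exact ⟨hu.abs_moment_le_of_le hR (by linarith) hα, hv.abs_moment_le_of_le hR (by linarith) hα,
    hw.abs_moment_le_of_le hR (by linarith) hα, hy.abs_moment_le_of_le hR (by linarith) hα⟩

lemma SDPFeasible.abs_le_momentBound {R : ℝ} (hR : S.IsRadius R) {r : ℕ} {s : SeqQuad n}
    (hs : S.SDPFeasible r s) {α : Fin n →₀ ℕ} (hα : α.degree ≤ 2 * r) :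
    |s.u α| ≤ S.momentBound R α ∧ |s.v α| ≤ S.momentBound R α ∧ |s.vHat α| ≤ S.momentBound R α ∧
      |s.y α| ≤ S.momentBound R α :=
  PolySystem.abs_le_momentBound hR hs.mass (hs.v_add_y 0 (by simp)) (hs.v_add_vHat 0 (by simp))
    hs.u_psd hs.v_psd hs.vHat_psd hs.y_psd hα

/-! ### Existence of optimal solutions of the semidefinite programs -/

/-- The sequences satisfying the linear invariance constraints of order `r`. -/
def invSubmodule (S : PolySystem n m) (r : ℕ) : Submodule ℝ ((Fin n →₀ ℕ) → ℝ) where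
  carrier := {u | (∀ α, S.truncDegree r < α.degree → u α = 0) ∧
    ∀ α, α.degree ≤ 2 * r → S.invFunctional u (monomial α 1) = 0}
  add_mem' {u u'} h h' := by
    refine ⟨fun α hα => by rw [Pi.add_apply, h.1 α hα, h'.1 α hα, add_zero], fun α hα => ?_⟩
    have e1 := h.2 α hα
    have e2 := h'.2 α hα
    rw [S.invFunctional_eq, ← rieszHom_apply] at *
    rw [rieszHom, map_add, LinearMap.add_apply, ← rieszHom, ← rieszHom, e1, e2, add_zero]
  zero_mem' := by
    refine ⟨fun α _ => rfl, fun α _ => ?_⟩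
    rw [S.invFunctional_eq, ← rieszHom_apply, rieszHom, map_zero, LinearMap.zero_apply]
  smul_mem' c u h := by
    refine ⟨fun α hα => by rw [Pi.smul_apply, h.1 α hα, smul_zero], fun α hα => ?_⟩
    have e1 := h.2 α hα
    rw [S.invFunctional_eq, ← rieszHom_apply] at *
    rw [rieszHom, map_smul, LinearMap.smul_apply, ← rieszHom, e1, smul_zero]

instance (S : PolySystem n m) (r : ℕ) : FiniteDimensional ℝ (S.invSubmodule r) := by
  have : Finite {β : Fin n →₀ ℕ // β.degree ≤ S.truncDegree r} :=
    (Finsupp.finite_of_degree_le (σ := Fin n) (S.truncDegree r)).to_subtype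
  let T : S.invSubmodule r →ₗ[ℝ] ({β : Fin n →₀ ℕ // β.degree ≤ S.truncDegree r} → ℝ) :=
    LinearMap.funLeft ℝ ℝ Subtype.val ∘ₗ (S.invSubmodule r).subtype
  refine FiniteDimensional.of_injective T fun u u' h => Subtype.ext (funext fun α => ?_)
  rcases le_or_gt α.degree (S.truncDegree r) with hα | hα
  · exact congrFun h ⟨α, hα⟩
  · rw [u.2.1 α hα, u'.2.1 α hα]

/-- The feasible set of order `r`, with the entries of `u` of degree larger than `2r` projected
away. -/
def projectedFeasible (S : PolySystem n m) (r : ℕ) :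
    Set (((Fin n →₀ ℕ) → ℝ) × ((Fin n →₀ ℕ) → ℝ) × ((Fin n →₀ ℕ) → ℝ) × ((Fin n →₀ ℕ) → ℝ)) :=
  {q | q.1 ∈ (S.invSubmodule r).map (truncateSeq (2 * r)) ∧
    (∀ α, 2 * r < α.degree → q.2.1 α = 0 ∧ q.2.2.1 α = 0 ∧ q.2.2.2 α = 0) ∧ q.1 0 = 1 ∧
    (∀ α, α.degree ≤ 2 * r → q.2.1 α + q.2.2.2 α = q.1 α) ∧
    (∀ α, α.degree ≤ 2 * r → q.2.1 α + q.2.2.1 α = momentSeq S.lebesgue α) ∧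
    S.LocPSD r q.1 ∧ S.LocPSD r q.2.1 ∧ S.LocPSD r q.2.2.1 ∧ S.LocPSD r q.2.2.2}

/-- The projected feasible set is compact: the moments up to degree `2r` are bounded, and the image
of the finite-dimensional space `invSubmodule` is closed. The moments of `u` of higher degree are
not bounded by the constraints, which is why they are projected away. -/
lemma isCompact_projectedFeasible {R : ℝ} (hR : S.IsRadius R) (r : ℕ) :
    IsCompact (S.projectedFeasible r) := by
  set B : Set ((Fin n →₀ ℕ) → ℝ) :=
    Set.univ.pi fun α => Set.Icc (-S.momentBound R α) (S.momentBound R α) with hB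
  have hBc : IsCompact B := isCompact_univ_pi fun α => isCompact_Icc
  have hpos : ∀ α, 0 ≤ S.momentBound R α := fun α => by
    have := hR.pos
    have := le_max_left 1 (momentSeq S.lebesgue 0)
    unfold momentBound
    positivity
  refine (hBc.prod (hBc.prod (hBc.prod hBc))).of_isClosed_subset ?_ ?_
  · have hW : IsClosed ((S.invSubmodule r).map (truncateSeq (2 * r)) :
        Set ((Fin n →₀ ℕ) → ℝ)) := Submodule.closed_of_finiteDimensional _
    have hP := S.isClosed_locPSD r
    simp only [projectedFeasible, Set.ofPred_and, Set.ofPred_forall]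
    refine (hW.preimage continuous_fst).inter (IsClosed.inter ?_ (IsClosed.inter ?_
      (IsClosed.inter ?_ (IsClosed.inter ?_ ((hP.preimage continuous_fst).inter
        ((hP.preimage (by fun_prop)).inter ((hP.preimage (by fun_prop)).inter
          (hP.preimage (by fun_prop)))))))))
    · exact isClosed_iInter fun α => isClosed_iInter fun _ =>
        (isClosed_eq (by fun_prop) (by fun_prop)).inter
          ((isClosed_eq (by fun_prop) (by fun_prop)).inter
            (isClosed_eq (by fun_prop) (by fun_prop)))
    · exact isClosed_eq (by fun_prop) (by fun_prop)
    · exact isClosed_iInter fun α => isClosed_iInter fun _ =>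
        isClosed_eq (by fun_prop) (by fun_prop)
    · exact isClosed_iInter fun α => isClosed_iInter fun _ =>
        isClosed_eq (by fun_prop) (by fun_prop)
  · rintro ⟨u, v, w, y⟩ ⟨⟨u', -, rfl⟩, h0, h1, h2, h3, hu, hv, hw, hy⟩
    have hb : ∀ α, |truncateSeq (2 * r) u' α| ≤ S.momentBound R α ∧ |v α| ≤ S.momentBound R α ∧
        |w α| ≤ S.momentBound R α ∧ |y α| ≤ S.momentBound R α := by
      intro α
      rcases le_or_gt α.degree (2 * r) with hα | hα
      · exact PolySystem.abs_le_momentBound hR h1 (h2 0 (by simp)) (h3 0 (by simp)) hu hv hw hy hα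
      · obtain ⟨e1, e2, e3⟩ := h0 α hα
        simp only at e1 e2 e3
        rw [e1, e2, e3, truncateSeq_of_lt _ hα, abs_zero]
        exact ⟨hpos α, hpos α, hpos α, hpos α⟩
    exact ⟨fun α _ => abs_le.1 (hb α).1, fun α _ => abs_le.1 (hb α).2.1,
      fun α _ => abs_le.1 (hb α).2.2.1, fun α _ => abs_le.1 (hb α).2.2.2⟩

lemma SDPFeasible.mem_projectedFeasible {r : ℕ} (hr : S.rMin ≤ r) {s : SeqQuad n}
    (hs : S.SDPFeasible r s) :
    (truncateSeq (2 * r) s.u, s.v, s.vHat, s.y) ∈ S.projectedFeasible r := by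
  refine ⟨⟨s.u, ⟨hs.u_zero_of_lt, hs.invariant⟩, rfl⟩, fun α hα => ⟨hs.v_zero_of_lt α hα,
    hs.vHat_zero_of_lt α hα, hs.y_zero_of_lt α hα⟩, ?_, fun α hα => ?_, hs.v_add_vHat,
    hs.u_psd.congr hr fun α hα => (truncateSeq_of_le _ hα).symm, hs.v_psd, hs.vHat_psd, hs.y_psd⟩
  · simp only
    rw [truncateSeq_of_le _ (by simp), hs.mass]
  · simp only
    rw [truncateSeq_of_le _ hα, hs.v_add_y α hα]

/-- The constraints of order `r` see `u` only through its entries up to degree `2r` and through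
membership in `invSubmodule`, so the projected points lift. -/
lemma exists_sdpFeasible_of_mem_projectedFeasible {r : ℕ} (hr : S.rMin ≤ r)
    {q : ((Fin n →₀ ℕ) → ℝ) × ((Fin n →₀ ℕ) → ℝ) × ((Fin n →₀ ℕ) → ℝ) × ((Fin n →₀ ℕ) → ℝ)}
    (hq : q ∈ S.projectedFeasible r) : ∃ s, S.SDPFeasible r s ∧ s.v = q.2.1 := by
  obtain ⟨⟨u, hu, hup⟩, h0, h1, h2, h3, pu, pv, pw, py⟩ := hq
  have hu' : ∀ α, α.degree ≤ 2 * r → q.1 α = u α := fun α hα => by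
    rw [← hup, truncateSeq_of_le _ hα]
  exact ⟨⟨u, q.2.1, q.2.2.1, q.2.2.2⟩, ⟨hu.1, fun α hα => (h0 α hα).1, fun α hα => (h0 α hα).2.1,
    fun α hα => (h0 α hα).2.2, by rw [← h1, hu' 0 (by simp)], hu.2,
    fun α hα => by rw [h2 α hα, hu' α hα], h3, pu.congr hr hu', pv, pw, py⟩, rfl⟩

theorem exists_sdpOptimal {R : ℝ} (hR : S.IsRadius R) {q : MeasureQuad n} (hq : S.LPFeasible q)
    {r : ℕ} (hr : S.rMin ≤ r) : ∃ s, S.SDPOptimal r s := by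
  have hne : (S.projectedFeasible r).Nonempty :=
    ⟨_, (hq.sdpFeasible hR.isCompact hr).mem_projectedFeasible hr⟩
  obtain ⟨x, hx, hmax⟩ := (isCompact_projectedFeasible hR r).exists_isMaxOn hne
    (f := fun q => q.2.1 0) (by fun_prop)
  obtain ⟨s, hs, hsv⟩ := exists_sdpFeasible_of_mem_projectedFeasible hr hx
  refine ⟨s, hs, fun s' hs' => ?_⟩
  rw [hsv]
  exact hmax (hs'.mem_projectedFeasible hr)

end PolySystem

/-! ### Convergence of the hierarchy -/

namespace PolySystem

variable {S : PolySystem n m}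

lemma LocPSD.mono {r k : ℕ} (hk : k ≤ r) {y : (Fin n →₀ ℕ) → ℝ} (hy : S.LocPSD r y) :
    S.LocPSD k y := by
  rw [S.locPSD_iff] at hy ⊢
  exact ⟨fun q hq => hy.1 q (hq.trans hk), fun j q hq => hy.2 j q (by omega)⟩

lemma IsMeasureOn.ext_of_momentSeq_eq (hX : IsCompact S.X) {μ ν : Measure (Fin n → ℝ)}
    (hμ : S.IsMeasureOn μ) (hν : S.IsMeasureOn ν) (h : ∀ α, momentSeq μ α = momentSeq ν α) :
    μ = ν := by
  have := hμ.1
  have := hν.1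
  refine ext_of_integral_eval_eq hX hμ.2 hν.2 fun p => ?_
  rw [← hμ.riesz_momentSeq hX, ← hν.riesz_momentSeq hX, funext h]

lemma IsMeasureOn.add {μ ν : Measure (Fin n → ℝ)} (hμ : S.IsMeasureOn μ) (hν : S.IsMeasureOn ν) :
    S.IsMeasureOn (μ + ν) := by
  have := hμ.1
  have := hν.1
  exact ⟨inferInstance, by rw [Measure.add_apply, hμ.2, hν.2, add_zero]⟩

end PolySystem

lemma exists_tendsto_of_abs_le {F : Ultrafilter ℕ} {f : ℕ → ℝ} {c : ℝ}
    (h : ∀ᶠ r in (F : Filter ℕ), |f r| ≤ c) : ∃ a, Tendsto f F (𝓝 a) := by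
  have hmem : ∀ᶠ x in (F.map f : Filter ℝ), x ∈ Set.Icc (-c) c :=
    eventually_map.2 (h.mono fun r hr => abs_le.1 hr)
  obtain ⟨a, -, ha⟩ := (isCompact_Icc (a := -c) (b := c)).ultrafilter_le_nhds (F.map f)
    (le_principal_iff.2 hmem)
  exact ⟨a, ha⟩

namespace PolySystem

variable {S : PolySystem n m}

/-- Along every ultrafilter, the optimal solutions of the semidefinite programs converge to the
moments of the optimal solution of the linear program: the limits satisfy the constraints of all
orders, hence are moment sequences of a feasible point of the linear program, whose value is at
least the optimal one. -/
lemma tendsto_ultrafilter {R : ℝ} (hR : S.IsRadius R) {μ : Measure (Fin n → ℝ)}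
    (hμ : S.IsInvariantProbability μ)
    (huniq : ∀ μ' : Measure (Fin n → ℝ), S.IsInvariantProbability μ' → μ' = μ)
    {s : ℕ → SeqQuad n} (hs : ∀ r, S.rMin ≤ r → S.SDPOptimal r (s r))
    {F : Ultrafilter ℕ} (hF : (F : Filter ℕ) ≤ atTop) (α : Fin n →₀ ℕ) :
    Tendsto (fun r => (s r).u α) F (𝓝 (momentSeq μ α)) ∧
      Tendsto (fun r => (s r).v α) F (𝓝 (momentSeq (S.cappedPart μ) α)) ∧
      Tendsto (fun r => (s r).vHat α) F (𝓝 (momentSeq (S.lebesgue - S.cappedPart μ) α)) ∧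
      Tendsto (fun r => (s r).y α) F (𝓝 (momentSeq (μ - S.cappedPart μ) α)) := by
  have hX := hR.isCompact
  have ev : ∀ k, ∀ᶠ r in (F : Filter ℕ), k ≤ r ∧ S.SDPOptimal r (s r) := fun k => by
    filter_upwards [hF (eventually_ge_atTop k), hF (eventually_ge_atTop S.rMin)] with r h1 h2
      using ⟨h1, hs r h2⟩
  have bd : ∀ α, ∀ᶠ r in (F : Filter ℕ), |(s r).u α| ≤ S.momentBound R α ∧
      |(s r).v α| ≤ S.momentBound R α ∧ |(s r).vHat α| ≤ S.momentBound R α ∧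
      |(s r).y α| ≤ S.momentBound R α := fun α => by
    filter_upwards [ev α.degree] with r hr
    exact hr.2.1.abs_le_momentBound hR (by omega)
  choose u hu using fun α => exists_tendsto_of_abs_le ((bd α).mono fun r h => h.1)
  choose v hv using fun α => exists_tendsto_of_abs_le ((bd α).mono fun r h => h.2.1)
  choose w hw using fun α => exists_tendsto_of_abs_le ((bd α).mono fun r h => h.2.2.1)
  choose y hy using fun α => exists_tendsto_of_abs_le ((bd α).mono fun r h => h.2.2.2)
  have psd : ∀ (t : ℕ → (Fin n →₀ ℕ) → ℝ) (t₀ : (Fin n →₀ ℕ) → ℝ),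
      (∀ α, Tendsto (fun r => t r α) F (𝓝 (t₀ α))) →
      (∀ r, S.SDPOptimal r (s r) → S.LocPSD r (t r)) →
      ∀ k, S.LocPSD k t₀ := fun t t₀ ht h k =>
    (S.isClosed_locPSD k).mem_of_tendsto (tendsto_pi_nhds.2 ht) <| by
      filter_upwards [ev k] with r hr using (h r hr.2).mono hr.1
  obtain ⟨μu, mu, rfl⟩ := hR.exists_measure (psd _ u hu fun r h => h.1.u_psd)
  obtain ⟨μv, mv, rfl⟩ := hR.exists_measure (psd _ v hv fun r h => h.1.v_psd)
  obtain ⟨μw, mw, rfl⟩ := hR.exists_measure (psd _ w hw fun r h => h.1.vHat_psd)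
  obtain ⟨μy, my, rfl⟩ := hR.exists_measure (psd _ y hy fun r h => h.1.y_psd)
  have hq : S.LPFeasible ⟨μu, μv, μw, μy⟩ := by
    refine ⟨mu, mv, mw, my, ?_, ?_, ?_, ?_⟩
    · have h1 : momentSeq μu 0 = 1 := tendsto_nhds_unique_of_eventuallyEq (hu 0)
        (tendsto_const_nhds (x := (1 : ℝ))) (by filter_upwards [ev 0] with r hr using hr.2.1.mass)
      rw [momentSeq_zero_eq, Measure.real, ENNReal.toReal_eq_one_iff] at h1
      exact h1
    · refine (mu.isInvariant_iff hX).2 fun α => ?_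
      rw [S.invFunctional_eq]
      refine tendsto_nhds_unique_of_eventuallyEq (tendsto_riesz hu _)
        (tendsto_const_nhds (x := (0 : ℝ))) ?_
      filter_upwards [ev α.degree] with r hr
      rw [← S.invFunctional_eq]
      exact hr.2.1.invariant α (by omega)
    · refine (mv.add my).ext_of_momentSeq_eq hX mu fun α => ?_
      rw [mv.momentSeq_add hX my]
      refine tendsto_nhds_unique_of_eventuallyEq ((hv α).add (hy α)) (hu α) ?_
      filter_upwards [ev α.degree] with r hr
      exact hr.2.1.v_add_y α (by omega)
    · refine (mv.add mw).ext_of_momentSeq_eq hX (isMeasureOn_lebesgue hX) fun α => ?_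
      rw [mv.momentSeq_add hX mw]
      refine tendsto_nhds_unique_of_eventuallyEq ((hv α).add (hw α)) tendsto_const_nhds ?_
      filter_upwards [ev α.degree] with r hr
      exact hr.2.1.v_add_vHat α (by omega)
  have hval : (S.cappedPart μ).real Set.univ ≤ μv.real Set.univ := by
    rw [← momentSeq_zero_eq μv]
    refine ge_of_tendsto (hv 0) ?_
    filter_upwards [ev S.rMin] with r hr
    have h1 := hr.2.2 _ ((lpFeasible_cappedPart hX hμ).sdpFeasible hX hr.1)
    simp only at h1
    rwa [truncateSeq_of_le _ (by simp), momentSeq_zero_eq] at h1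
  have heq := hq.eq_of_le hX huniq hval
  rw [MeasureQuad.mk.injEq] at heq
  obtain ⟨rfl, e2, e3, e4⟩ := heq
  rw [← e2, ← e3, ← e4] at *
  exact ⟨hu α, hv α, hw α, hy α⟩

theorem tendsto_sdpOptimal {R : ℝ} (hR : S.IsRadius R) {μ : Measure (Fin n → ℝ)}
    (hμ : S.IsInvariantProbability μ)
    (huniq : ∀ μ' : Measure (Fin n → ℝ), S.IsInvariantProbability μ' → μ' = μ)
    {s : ℕ → SeqQuad n} (hs : ∀ r, S.rMin ≤ r → S.SDPOptimal r (s r)) (α : Fin n →₀ ℕ) :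
    Tendsto (fun r => (s r).u α) atTop (𝓝 (momentSeq μ α)) ∧
      Tendsto (fun r => (s r).v α) atTop (𝓝 (momentSeq (S.cappedPart μ) α)) ∧
      Tendsto (fun r => (s r).vHat α) atTop (𝓝 (momentSeq (S.lebesgue - S.cappedPart μ) α)) ∧
      Tendsto (fun r => (s r).y α) atTop (𝓝 (momentSeq (μ - S.cappedPart μ) α)) := by
  have h := fun (F : Ultrafilter ℕ) hF => tendsto_ultrafilter hR hμ huniq hs (F := F) hF α
  simp only [tendsto_iff_ultrafilter _ atTop]
  exact ⟨fun F hF => (h F hF).1, fun F hF => (h F hF).2.1, fun F hF => (h F hF).2.2.1,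
    fun F hF => (h F hF).2.2.2⟩

lemma SDPOptimal.sdpValue_eq {r : ℕ} {s : SeqQuad n} (hs : S.SDPOptimal r s) :
    S.sdpValue r = ((s.v 0 : ℝ) : EReal) := by
  refine le_antisymm (iSup₂_le fun s' hs' => EReal.coe_le_coe_iff.2 (hs.2 s' hs')) ?_
  exact le_iSup₂ (f := fun (s : SeqQuad n) (_ : S.SDPFeasible r s) => ((s.v 0 : ℝ) : EReal)) s hs.1

end PolySystem

end InvariantSDP

theorem mainTheorem1 {n m : ℕ} (S : InvariantSDP.PolySystem n m) (hS : S.Archimedean)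
    (μ : Measure (Fin n → ℝ)) (hμ : S.IsInvariantProbability μ)
    (huniq : ∀ μ' : Measure (Fin n → ℝ), S.IsInvariantProbability μ' → μ' = μ) :
    (∀ q : InvariantSDP.MeasureQuad n, S.LPOptimal q ↔
      q = ⟨μ, S.cappedPart μ, S.lebesgue - S.cappedPart μ, μ - S.cappedPart μ⟩) ∧
    (∀ r, S.rMin ≤ r → ∃ s, S.SDPOptimal r s) ∧
    (∀ s : ℕ → InvariantSDP.SeqQuad n, (∀ r, S.rMin ≤ r → S.SDPOptimal r (s r)) →
      ∀ α : Fin n →₀ ℕ,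
        Tendsto (fun r => (s r).u α) atTop (𝓝 (InvariantSDP.momentSeq μ α)) ∧
        Tendsto (fun r => (s r).v α) atTop (𝓝 (InvariantSDP.momentSeq (S.cappedPart μ) α)) ∧
        Tendsto (fun r => (s r).vHat α) atTop
          (𝓝 (InvariantSDP.momentSeq (S.lebesgue - S.cappedPart μ) α)) ∧
        Tendsto (fun r => (s r).y α) atTop
          (𝓝 (InvariantSDP.momentSeq (μ - S.cappedPart μ) α))) ∧
    (∀ α : Fin n →₀ ℕ,
      InvariantSDP.momentSeq (S.lebesgue - S.cappedPart μ) α =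
        InvariantSDP.momentSeq S.lebesgue α - InvariantSDP.momentSeq (S.cappedPart μ) α ∧
      InvariantSDP.momentSeq (μ - S.cappedPart μ) α =
        InvariantSDP.momentSeq μ α - InvariantSDP.momentSeq (S.cappedPart μ) α) ∧
    Tendsto S.sdpValue atTop (𝓝 S.lpValue) := by
  obtain ⟨R, hR⟩ := hS.exists_isRadius
  have hX := hR.isCompact
  have hq := InvariantSDP.PolySystem.lpFeasible_cappedPart hX hμ
  have hex : ∀ r, S.rMin ≤ r → ∃ s, S.SDPOptimal r s := fun r hr =>
    InvariantSDP.PolySystem.exists_sdpOptimal hR hq hr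
  refine ⟨InvariantSDP.PolySystem.lpOptimal_iff hX hμ huniq, hex, fun s hs α =>
    InvariantSDP.PolySystem.tendsto_sdpOptimal hR hμ huniq hs α, fun α => ⟨?_, ?_⟩, ?_⟩
  · have h1 := hq.nu_mem.momentSeq_add hX hq.nuHat_mem α
    rw [hq.nu_add_nuHat] at h1
    exact eq_sub_of_add_eq' h1.symm
  · have h1 := hq.nu_mem.momentSeq_add hX hq.psi_mem α
    rw [hq.nu_add_psi] at h1
    exact eq_sub_of_add_eq' h1.symm
  · have : Nonempty (InvariantSDP.SeqQuad n) := ⟨⟨0, 0, 0, 0⟩⟩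
    choose! s hs using hex
    rw [InvariantSDP.PolySystem.lpValue_eq hX hμ huniq, ← InvariantSDP.momentSeq_zero_eq]
    have h1 := (InvariantSDP.PolySystem.tendsto_sdpOptimal hR hμ huniq hs 0).2.1
    refine (EReal.tendsto_coe.2 h1).congr' ?_
    filter_upwards [eventually_ge_atTop S.rMin] with r hr using (hs r hr).sdpValue_eq.symm
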